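/- Theorem 1.1. For $u_0\in\mathcal S(\mathbb R)$ put $\mathcal F u_0(p)=\int_{\mathbb R}u_0(x)e^{-ixp}\,dx$ and $$u_S(t,x)=\frac1{2\pi}\int_{\mathbb R}\mathcal F u_0(p)\,e^{-\frac12 itp^2+ixp}\,dp\qquad(t,x\in\mathbb R).$$ Let $p_1<p_2$, $\tilde p_1$, $\tilde p_2$ be real numbers with $[p_1,p_2]\subset(\tilde p_1,\tilde p_2)$, and suppose that $\|u_0\|_{L^2(\mathbb R)}=1$ and $\operatorname{supp}\mathcal F u_0\subseteq[p_1,p_2]$. Then $u_S$ is a classical solution of the free Schrödinger equation $i\partial_t u_S=-\frac12\partial_{xx}u_S$, $u_S(0)=u_0$; the first and second moments of $|u_S(\tau,\cdot)|^2$ are finite for every $\tau\in\mathbb R$; and the variance $$V(\tau)=\int_{\mathbb R}x^2|u_S(\tau,x)|^2\,dx-\Big(\int_{\mathbb R}x\,|u_S(\tau,x)|^2\,dx\Big)^2$$ has a unique minimiser $t^*\in\mathbb R$. Put $x^*=\int_{\mathbb R}x\,|u_S(t^*,x)|^2\,dx$ and, for $t\ne t^*$, $v=v(t,x)=\frac{x-x^*}{t-t^*}$.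 (i) For every $\delta\in(\frac12,\frac34)$ and all $(t,x)$ with $t\neq t^*$ and $\tilde p_1\le v\le\tilde p_2$, $$\left|u_S(t,x)-\frac1{\sqrt{2\pi}}\,e^{-\operatorname{sgn}(t-t^*)i\frac\pi4}\,e^{-\frac12 itv^2+ixv}\,\mathcal F u_0(v)\,|t-t^*|^{-\frac12}\right|\le C_1\sqrt{V(t^*)}\,|t-t^*|^{-\delta}.$$ (ii) For all $(t,x)$ with $t\ne t^*$ and either $v<\tilde p_1$ or $v>\tilde p_2$, $$|u_S(t,x)|\le\Big(C_2\sqrt{V(t^*)}+C_3\|u_0\|_{L^1(\mathbb R)}\Big)|t-t^*|^{-1}.$$ Here $$C_1=\frac{2^{\delta+\frac12}L(\delta)}{\sqrt\pi\,\sqrt{3-4\delta}}\,(\tilde p_2-\tilde p_1)^{\frac{3-4\delta}2},\qquad L(\delta)=\frac{\sqrt\pi}2\left(\frac1{2\sqrt\pi}+\sqrt{\frac1{4\pi}+\frac12}\right)^{2\delta-1},$$ $$C_2=\frac{(p_2-p_1)^{\frac12}}{\sqrt{2\pi}\,\min\{p_1-\tilde p_1,\tilde p_2-p_2\}},\qquad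 C_3=\frac1{2\pi\,\min\{p_1-\tilde p_1,\tilde p_2-p_2\}}.$$ -/

import Mathlib

noncomputable section

namespace FreeSchrodinger

open Complex MeasureTheory

/-- The Fourier transform on the line, normalised as `F u (p) = ∫ u(x) e^{-ixp} dx`. -/
def fourier (u : ℝ → ℂ) (p : ℝ) : ℂ :=
  ∫ x : ℝ, u x * exp (-(I * x * p))

/-- The wave function
`u_S(t,x) = (1/2π) ∫ F u₀(p) e^{-i t p² / 2 + i x p} dp`. -/
def uS (u₀ : ℝ → ℂ) (t x : ℝ) : ℂ :=
  (1 / (2 * Real.pi) : ℂ) *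
    ∫ p : ℝ, fourier u₀ p * exp (-(1 / 2 : ℂ) * I * t * (p : ℂ) ^ 2 + I * x * p)

/-- `u` is a classical solution of `i ∂ₜ u = -(1/2) ∂ₓₓ u` for all times, with `u(0) = u₀`. -/
def IsClassicalSolution (u₀ : ℝ → ℂ) (u : ℝ → ℝ → ℂ) : Prop :=
  (∀ x : ℝ, u 0 x = u₀ x) ∧
  (∀ t x : ℝ, DifferentiableAt ℝ (fun s : ℝ => u s x) t) ∧
  (∀ t : ℝ, ContDiff ℝ 2 (u t)) ∧
  (∀ t x : ℝ, I * deriv (fun s : ℝ => u s x) t = -(1 / 2 : ℂ) * iteratedDeriv 2 (u t) x)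

/-- The mean position of `|v|²`. -/
def mean (v : ℝ → ℂ) : ℝ := ∫ x : ℝ, x * ‖v x‖ ^ 2

/-- The variance of `|v|²`, for `v` of unit `L²` norm. -/
def variance (v : ℝ → ℂ) : ℝ := (∫ x : ℝ, x ^ 2 * ‖v x‖ ^ 2) - (∫ x : ℝ, x * ‖v x‖ ^ 2) ^ 2

/-- The constant `L(δ) = (√π / 2) (1/(2√π) + √(1/(4π) + 1/2))^{2δ-1}`. -/
def L (δ : ℝ) : ℝ :=
  Real.sqrt Real.pi / 2 *
    (1 / (2 * Real.sqrt Real.pi) + Real.sqrt (1 / (4 * Real.pi) + 1 / 2)) ^ (2 * δ - 1)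

/-- The constant of the estimate inside the cone with slopes in `[q₁, q₂]`. -/
def C₁ (δ q₁ q₂ : ℝ) : ℝ :=
  (2 : ℝ) ^ (δ + 1 / 2) * L δ / (Real.sqrt Real.pi * Real.sqrt (3 - 4 * δ)) *
    (q₂ - q₁) ^ ((3 - 4 * δ) / 2)

/-- The constant in front of the standard deviation in the estimate outside the cone. -/
def C₂ (p₁ p₂ q₁ q₂ : ℝ) : ℝ :=
  1 / Real.sqrt (2 * Real.pi) * Real.sqrt (p₂ - p₁) * (min (p₁ - q₁) (q₂ - p₂))⁻¹

/-- The constant in front of the `L¹` norm in the estimate outside the cone. -/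
def C₃ (p₁ p₂ q₁ q₂ : ℝ) : ℝ :=
  1 / (2 * Real.pi) * (min (p₁ - q₁) (q₂ - p₂))⁻¹

/-- The first term of the expansion in the cone with origin `(t₀, x₀)`:
`(2π)^{-1/2} e^{-i sgn(t-t₀) π/4} e^{-i t v²/2 + i x v} F u₀(v) |t-t₀|^{-1/2}`, where
`v = (x-x₀)/(t-t₀)`. -/
def firstTerm (u₀ : ℝ → ℂ) (t₀ x₀ t x : ℝ) : ℂ :=
  let v : ℝ := (x - x₀) / (t - t₀)
  ((1 / Real.sqrt (2 * Real.pi) : ℝ) : ℂ) *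
    exp (-((Real.sign (t - t₀) : ℝ) : ℂ) * I * (Real.pi / 4)) *
    exp (-(1 / 2 : ℂ) * I * t * (v : ℂ) ^ 2 + I * x * v) *
    fourier u₀ v * ((|t - t₀| ^ (-(1 / 2) : ℝ) : ℝ) : ℂ)

end FreeSchrodinger

end

noncomputable section

namespace FreeSchrodinger

open Complex MeasureTheory

open scoped FourierTransform SchwartzMap ContDiff

/-! Put `f = fourier u₀`, `T = t - t*` and `x = x* + T v`. Completing the square in the phase about
`p = v` gives `u_S(t,x) = (1/2π) e^{iTv²/2} ∫ g(p) e^{-iT(p-v)²/2} dp`, where `g(p) = f(p)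
e^{-it*p²/2 + ix*p}` is `modulate f t* x*`. The origin of the cone is thus absorbed into the
amplitude. Multiplication by `x` corresponds to `i d/dp`, so Plancherel gives `∫ |g'|² = 2π ∫ (x -
x*)² |u_S(t*,x)|² dx`, which is `2π V(t*)` because `x*` is the mean (`variance_uS`). Both estimates
therefore need only bounds in terms of the `L²` norm of `g'`.

Inside the cone (`norm_integral_sub_stationary_le`) the integral is split at `v` and integrated by
parts against the Fresnel tail. The boundary terms at `v` form the first term of the expansion. In
the remainder the tail is at most a constant times `|T|^{-δ} s^{1-2δ}` at distance `s` from `v`;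
this is square integrable near `0` exactly when `δ < 3/4`, so Cauchy–Schwarz applies.

Outside the cone (`norm_integral_nonstationary_le`) `v` keeps a fixed distance from the support of
`g`, and one integration by parts after division by `p - v` gains `|T|⁻¹`.

The same Plancherel identity, expanded in `τ` and the centre `m`, shows that the variance is
quadratic in `τ`. Its leading coefficient is the variance of the momentum density `|f|²/2π`,
positive because that density is not concentrated at a point; hence the unique minimiser. -/

/-! ### The Fresnel tail on a rotated contour -/

/-- The slope `2 e^{iπ/4}` of the rotated contour. -/
def contourSlope : ℂ := 2 * exp (I * (Real.pi / 4))

lemma contourSlope_mul_exp : contourSlope * exp (-I * (Real.pi / 4)) = 2 := by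
  rw [contourSlope, mul_assoc, ← exp_add]
  simp

lemma contourSlope_sq : contourSlope ^ 2 = 4 * I := by
  rw [contourSlope, mul_pow, ← exp_nat_mul]
  have : ((2 : ℕ) : ℂ) * (I * (Real.pi / 4)) = Real.pi / 2 * I := by push_cast; ring
  rw [this, exp_pi_div_two_mul_I]
  norm_num

lemma contourSlope_re : contourSlope.re = Real.sqrt 2 := by
  have : contourSlope = 2 * exp (((Real.pi / 4 : ℝ) : ℂ) * I) := by
    rw [contourSlope]; push_cast; ring_nf
  rw [this, exp_mul_I, ← ofReal_cos, ← ofReal_sin, Real.cos_pi_div_four, Real.sin_pi_div_four]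
  simp only [mul_re, add_re, ofReal_re, I_re, ofReal_im, I_im, re_ofNat, im_ofNat]
  ring

/-- The integrand of the Fresnel tail after rotation of the contour. -/
def rotatedIntegrand (y r : ℝ) : ℂ := exp (-(r : ℂ) ^ 2 - contourSlope * y * r)

lemma norm_rotatedIntegrand (y r : ℝ) :
    ‖rotatedIntegrand y r‖ = Real.exp (-r ^ 2 - Real.sqrt 2 * y * r) := by
  rw [rotatedIntegrand, norm_exp]
  congr 1
  have : (-(r : ℂ) ^ 2 - contourSlope * y * r).re = -r ^ 2 - contourSlope.re * y * r := by
    rw [← ofReal_pow, sub_re, neg_re, ofReal_re, re_mul_ofReal, re_mul_ofReal]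
  rw [this, contourSlope_re]

/-- Completing a square absorbs the cross term for either sign of `y`, which gives a Gaussian
majorant locally uniform in `y`. -/
lemma norm_rotatedIntegrand_le (y r : ℝ) :
    ‖rotatedIntegrand y r‖ ≤ Real.exp (y ^ 2) * Real.exp (-(1 / 2) * r ^ 2) := by
  rw [norm_rotatedIntegrand, ← Real.exp_add, Real.exp_le_exp]
  nlinarith [sq_nonneg (Real.sqrt 2 * y + r), Real.sq_sqrt (show (0 : ℝ) ≤ 2 by norm_num)]

@[fun_prop]
lemma continuous_rotatedIntegrand (y : ℝ) : Continuous (rotatedIntegrand y) := by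
  unfold rotatedIntegrand; fun_prop

lemma integrable_rotatedIntegrand (y : ℝ) : Integrable (rotatedIntegrand y) := by
  refine ((integrable_exp_neg_mul_sq (b := 1 / 2) (by norm_num)).const_mul
    (Real.exp (y ^ 2))).mono' (by fun_prop) ?_
  exact Filter.Eventually.of_forall fun r => norm_rotatedIntegrand_le y r

lemma norm_mul_rotatedIntegrand_le (y r : ℝ) :
    ‖(r : ℂ) * rotatedIntegrand y r‖ ≤
      Real.exp (y ^ 2) * ‖r * Real.exp (-(1 / 2) * r ^ 2)‖ := by
  rw [norm_mul, norm_mul, norm_real, Real.norm_of_nonneg (Real.exp_nonneg _)]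
  nlinarith [norm_rotatedIntegrand_le y r, norm_nonneg r]

lemma integrable_mul_rotatedIntegrand (y : ℝ) :
    Integrable (fun r : ℝ => (r : ℂ) * rotatedIntegrand y r) := by
  refine ((integrable_mul_exp_neg_mul_sq (b := 1 / 2) (by norm_num)).norm.const_mul
    (Real.exp (y ^ 2))).mono' (by fun_prop) ?_
  exact Filter.Eventually.of_forall fun r => norm_mul_rotatedIntegrand_le y r

lemma hasDerivAt_rotatedIntegrand_left (y r : ℝ) :
    HasDerivAt (fun y => rotatedIntegrand y r) (-contourSlope * (r * rotatedIntegrand y r)) y := by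
  unfold rotatedIntegrand
  have h1 : HasDerivAt (fun y : ℝ => -(r : ℂ) ^ 2 - contourSlope * y * r)
      (-(contourSlope * 1 * r)) y :=
    (((ofRealCLM.hasDerivAt (x := y)).const_mul contourSlope).mul_const (r : ℂ)).const_sub _
  convert! h1.cexp using 1
  ring

lemma hasDerivAt_rotatedIntegrand_right (y r : ℝ) :
    HasDerivAt (rotatedIntegrand y)
      (-2 * (r * rotatedIntegrand y r) - contourSlope * y * rotatedIntegrand y r) r := by
  unfold rotatedIntegrand
  have h0 : HasDerivAt (fun r : ℝ => (r : ℂ)) 1 r := ofRealCLM.hasDerivAt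
  have h1 : HasDerivAt (fun r : ℝ => -(r : ℂ) ^ 2 - contourSlope * y * r)
      (-(2 * r) - contourSlope * y * 1) r := by
    convert! (h0.pow 2).neg.sub (h0.const_mul (contourSlope * y)) using 1
    simp
  convert! h1.cexp using 1
  ring

/-- `∫₀^∞ e^{-r² - 2 e^{iπ/4} y r} dr`. -/
def rotatedIntegral (y : ℝ) : ℂ := ∫ r in Set.Ioi (0 : ℝ), rotatedIntegrand y r

lemma tendsto_rotatedIntegrand (y : ℝ) :
    Filter.Tendsto (rotatedIntegrand y) Filter.atTop (nhds 0) := by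
  refine squeeze_zero_norm (norm_rotatedIntegrand_le y) ?_
  rw [← mul_zero (Real.exp (y ^ 2))]
  refine Filter.Tendsto.const_mul _ (Real.tendsto_exp_atBot.comp ?_)
  exact (Filter.tendsto_pow_atTop two_ne_zero).const_mul_atTop_of_neg (by norm_num)

/-- Integrating the `r`-derivative of the integrand over the half-line eliminates the first moment
in favour of `rotatedIntegral`. This closes the differential equation in
`hasDerivAt_rotatedIntegral`. -/
lemma setIntegral_mul_rotatedIntegrand (y : ℝ) :
    2 * ∫ r in Set.Ioi (0 : ℝ), (r : ℂ) * rotatedIntegrand y r =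
      1 - contourSlope * y * rotatedIntegral y := by
  have hi1 := (integrable_mul_rotatedIntegrand y).integrableOn (s := Set.Ioi 0) |>.const_mul (-2)
  have hi2 := (integrable_rotatedIntegrand y).integrableOn (s := Set.Ioi 0)
    |>.const_mul (contourSlope * y)
  have := integral_Ioi_of_hasDerivAt_of_tendsto' (a := 0)
    (fun r _ => hasDerivAt_rotatedIntegrand_right y r) (hi1.sub hi2) (tendsto_rotatedIntegrand y)
  rw [integral_sub hi1 hi2, integral_const_mul, integral_const_mul] at this
  have h0 : rotatedIntegrand y 0 = 1 := by simp [rotatedIntegrand]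
  rw [h0] at this
  rw [rotatedIntegral]
  linear_combination -this

lemma hasDerivAt_rotatedIntegral (y : ℝ) :
    HasDerivAt rotatedIntegral
      (-contourSlope / 2 + 2 * I * y * rotatedIntegral y) y := by
  have key := (hasDerivAt_integral_of_dominated_loc_of_deriv_le
    (μ := volume.restrict (Set.Ioi (0 : ℝ))) (F := rotatedIntegrand) (x₀ := y)
    (s := Metric.ball y 1)
    (F' := fun y r => -contourSlope * (r * rotatedIntegrand y r))
    (bound := fun r => ‖contourSlope‖ * (Real.exp ((|y| + 1) ^ 2) *
      ‖r * Real.exp (-(1 / 2) * r ^ 2)‖))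
    (Metric.ball_mem_nhds y one_pos)
    (Filter.Eventually.of_forall fun z => by fun_prop)
    (integrable_rotatedIntegrand y).integrableOn (by fun_prop)
    (Filter.Eventually.of_forall fun r z hz => ?_)
    (((integrable_mul_exp_neg_mul_sq (b := 1 / 2) (by norm_num)).norm.const_mul _).const_mul
      _).integrableOn
    (Filter.Eventually.of_forall fun r z _ => hasDerivAt_rotatedIntegrand_left z r)).2
  · rw [integral_const_mul] at key
    convert! key using 1
    linear_combination (contourSlope / 2) * setIntegral_mul_rotatedIntegrand y
      - y * rotatedIntegral y / 2 * contourSlope_sq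
  · rw [norm_mul, norm_neg]
    refine mul_le_mul_of_nonneg_left ((norm_mul_rotatedIntegrand_le z r).trans ?_) (norm_nonneg _)
    refine mul_le_mul_of_nonneg_right (Real.exp_le_exp.2 ?_) (norm_nonneg _)
    rw [Metric.mem_ball, Real.dist_eq] at hz
    rw [← sq_abs z]
    have : |z| ≤ |y| + 1 := by
      have := abs_sub_abs_le_abs_sub z y
      linarith
    gcongr

lemma rotatedIntegral_zero : rotatedIntegral 0 = (Real.sqrt Real.pi / 2 : ℝ) := by
  have := integral_gaussian_Ioi 1
  rw [div_one] at this
  rw [← this, ← integral_complex_ofReal, rotatedIntegral]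
  refine setIntegral_congr_fun measurableSet_Ioi fun r _ => ?_
  simp [rotatedIntegrand]

lemma norm_rotatedIntegral_le {y : ℝ} (hy : 0 ≤ y) :
    ‖rotatedIntegral y‖ ≤ Real.sqrt Real.pi / 2 := by
  have := integral_gaussian_Ioi 1
  rw [div_one] at this
  rw [← this]
  refine norm_integral_le_of_norm_le (integrable_exp_neg_mul_sq one_pos).integrableOn ?_
  refine (ae_restrict_iff' measurableSet_Ioi).2 (Filter.Eventually.of_forall fun r hr => ?_)
  rw [norm_rotatedIntegrand, Real.exp_le_exp]
  have : 0 ≤ Real.sqrt 2 * y * r := by have := Set.mem_Ioi.1 hr; positivity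
  linarith

/-- Here the Gaussian factor is discarded and the exponential kept; in `norm_rotatedIntegral_le` it
is the other way round. -/
lemma mul_norm_rotatedIntegral_le {y : ℝ} (hy : 0 < y) :
    y * ‖rotatedIntegral y‖ ≤ 1 / Real.sqrt 2 := by
  have hneg : -(Real.sqrt 2 * y) < 0 := by
    have : 0 < Real.sqrt 2 * y := by positivity
    linarith
  have h : ‖rotatedIntegral y‖ ≤ 1 / (Real.sqrt 2 * y) := by
    have h1 := integral_exp_mul_Ioi hneg 0
    have h2 : -Real.exp (-(Real.sqrt 2 * y) * 0) / -(Real.sqrt 2 * y) = 1 / (Real.sqrt 2 * y) := by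
      rw [mul_zero, Real.exp_zero, neg_div_neg_eq]
    rw [← h2, ← h1]
    refine norm_integral_le_of_norm_le (integrableOn_exp_mul_Ioi hneg 0) ?_
    refine Filter.Eventually.of_forall fun r => ?_
    rw [norm_rotatedIntegrand, Real.exp_le_exp]
    nlinarith [sq_nonneg r]
  calc y * ‖rotatedIntegral y‖ ≤ y * (1 / (Real.sqrt 2 * y)) := by gcongr
    _ = 1 / Real.sqrt 2 := by field_simp

/-- The Fresnel tail `∫_y^∞ e^{-i w²} dw`, written through its rotated contour integral. -/
def fresnelTail (y : ℝ) : ℂ :=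
  exp (-I * (Real.pi / 4)) * (exp (-I * (y : ℂ) ^ 2) * rotatedIntegral y)

/-- The factor `e^{-iy²}` cancels the homogeneous part of the equation for `rotatedIntegral`.
Integration by parts needs only this antiderivative, its value at `0` and its decay, so no contour
shift has to be justified. -/
lemma hasDerivAt_fresnelTail (y : ℝ) :
    HasDerivAt fresnelTail (-exp (-I * (y : ℂ) ^ 2)) y := by
  have h0 : HasDerivAt (fun r : ℝ => (r : ℂ)) 1 y := ofRealCLM.hasDerivAt
  have h1 := ((h0.pow 2).const_mul (-I)).cexp
  convert! (h1.mul (hasDerivAt_rotatedIntegral y)).const_mul (exp (-I * (Real.pi / 4))) using 1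
  simp only [Pi.pow_apply, Nat.cast_ofNat, Nat.add_one_sub_one, pow_one, mul_one]
  linear_combination (exp (-I * (y : ℂ) ^ 2) / 2) * contourSlope_mul_exp

lemma fresnelTail_zero :
    fresnelTail 0 = exp (-I * (Real.pi / 4)) * (Real.sqrt Real.pi / 2 : ℝ) := by
  simp [fresnelTail, rotatedIntegral_zero]

lemma norm_fresnelTail (y : ℝ) : ‖fresnelTail y‖ = ‖rotatedIntegral y‖ := by
  have h1 : exp (-I * (Real.pi / 4)) = exp (((-(Real.pi / 4) : ℝ) : ℂ) * I) := by
    push_cast; ring_nf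
  have h2 : exp (-I * (y : ℂ) ^ 2) = exp (((-y ^ 2 : ℝ) : ℂ) * I) := by
    push_cast; ring_nf
  rw [fresnelTail, norm_mul, norm_mul, h1, h2, norm_exp_ofReal_mul_I, norm_exp_ofReal_mul_I,
    one_mul, one_mul]

/-- With `a` the base of the power in `L δ`, the uniform bound and the `1/y` bound give `√π/2 * min
1 (a/y)`; since `0 < 2δ - 1 < 1`, the minimum is at most `(a/y)^(2δ-1)`. -/
lemma norm_fresnelTail_le {δ y : ℝ} (h1 : 1 / 2 < δ) (h2 : δ < 3 / 4) (hy : 0 < y) :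
    ‖fresnelTail y‖ ≤ L δ * y ^ (1 - 2 * δ) := by
  set a := 1 / (2 * Real.sqrt Real.pi) + Real.sqrt (1 / (4 * Real.pi) + 1 / 2) with ha
  have hs : 1 / Real.sqrt 2 ≤ Real.sqrt (1 / (4 * Real.pi) + 1 / 2) := by
    rw [one_div, ← Real.sqrt_inv]
    refine Real.sqrt_le_sqrt ?_
    have : 0 < 1 / (4 * Real.pi) := by positivity
    norm_num at *; linarith
  have hapos : 0 < a := by positivity
  -- The product on the right is at least `1/4 + 0.85/√2`, and `0.15/√2 ≤ 1/4`.
  have haS : 1 / Real.sqrt 2 ≤ Real.sqrt Real.pi / 2 * a := by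
    have hpi : (1.7 : ℝ) ≤ Real.sqrt Real.pi := by
      refine Real.le_sqrt_of_sq_le ?_
      nlinarith [Real.pi_gt_three]
    have h3 : Real.sqrt Real.pi / 2 * (1 / (2 * Real.sqrt Real.pi)) = 1 / 4 := by
      have : Real.sqrt Real.pi ≠ 0 := by positivity
      field_simp; norm_num
    have h4 : 1 / Real.sqrt 2 ≤ 1 := by
      rw [div_le_one (by positivity)]
      exact Real.one_le_sqrt.2 (by norm_num)
    rw [ha, mul_add, h3]
    have h5 : (0.85 : ℝ) * (1 / Real.sqrt 2) ≤
        Real.sqrt Real.pi / 2 * Real.sqrt (1 / (4 * Real.pi) + 1 / 2) :=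
      mul_le_mul (by linarith) hs (by positivity) (by positivity)
    linarith
  rw [norm_fresnelTail]
  have hB1 := norm_rotatedIntegral_le hy.le
  have hB2 : y * ‖rotatedIntegral y‖ ≤ Real.sqrt Real.pi / 2 * a :=
    (mul_norm_rotatedIntegral_le hy).trans haS
  have hL : L δ * y ^ (1 - 2 * δ) = Real.sqrt Real.pi / 2 * (a / y) ^ (2 * δ - 1) := by
    rw [L, Real.div_rpow hapos.le hy.le, show 1 - 2 * δ = -(2 * δ - 1) by ring,
      Real.rpow_neg hy.le, ← ha]
    ring
  rw [hL]
  rcases le_total y a with h | h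
  · have : 1 ≤ (a / y) ^ (2 * δ - 1) :=
      Real.one_le_rpow ((one_le_div hy).2 h) (by linarith)
    nlinarith [Real.sqrt_nonneg Real.pi]
  · have : (a / y) ^ (1 : ℝ) ≤ (a / y) ^ (2 * δ - 1) :=
      Real.rpow_le_rpow_of_exponent_ge (by positivity) ((div_le_one hy).2 h) (by linarith)
    rw [Real.rpow_one] at this
    have h5 : ‖rotatedIntegral y‖ ≤ Real.sqrt Real.pi / 2 * (a / y) := by
      rw [← mul_div_assoc, le_div_iff₀ hy]
      linarith
    refine h5.trans ?_
    gcongr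

/-! ### Stationary phase -/

/-- The tail `∫_s^∞ e^{-i T r² / 2} dr` for `T > 0`. -/
def scaledTail (T s : ℝ) : ℂ := Real.sqrt (2 / T) * fresnelTail (Real.sqrt (T / 2) * s)

lemma hasDerivAt_scaledTail {T : ℝ} (hT : 0 < T) (s : ℝ) :
    HasDerivAt (scaledTail T) (-exp (-I * (T / 2) * (s : ℂ) ^ 2)) s := by
  have h1 : HasDerivAt (fun s : ℝ => Real.sqrt (T / 2) * s) (Real.sqrt (T / 2)) s := by
    simpa using (hasDerivAt_id s).const_mul (Real.sqrt (T / 2))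
  have h2 := ((hasDerivAt_fresnelTail (Real.sqrt (T / 2) * s)).scomp s h1).const_mul
    ((Real.sqrt (2 / T) : ℝ) : ℂ)
  convert! h2 using 1
  have h3 : ((Real.sqrt (2 / T) : ℝ) : ℂ) * (Real.sqrt (T / 2) : ℝ) = 1 := by
    rw [← ofReal_mul, ← Real.sqrt_mul (by positivity)]
    have : 2 / T * (T / 2) = 1 := by field_simp
    rw [this]; simp
  have h4 : ((Real.sqrt (T / 2) : ℝ) : ℂ) ^ 2 = T / 2 := by
    rw [← ofReal_pow, Real.sq_sqrt (by positivity)]; push_cast; ring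
  rw [real_smul, ← mul_assoc, h3, one_mul, ofReal_mul, mul_pow, h4]
  ring_nf

lemma scaledTail_zero {T : ℝ} (hT : 0 < T) :
    2 * scaledTail T 0 = Real.sqrt (2 * Real.pi) * exp (-I * (Real.pi / 4)) *
      ((T ^ (-(1 / 2) : ℝ) : ℝ) : ℂ) := by
  rw [scaledTail, mul_zero, fresnelTail_zero]
  have : Real.sqrt (2 / T) * Real.sqrt Real.pi =
      Real.sqrt (2 * Real.pi) * T ^ (-(1 / 2) : ℝ) := by
    rw [Real.rpow_neg hT.le, ← Real.sqrt_eq_rpow, Real.sqrt_div (by norm_num),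
      Real.sqrt_mul (by norm_num)]
    ring
  have h := congrArg (fun r : ℝ => (r : ℂ)) this
  push_cast at h ⊢
  linear_combination exp (-I * (Real.pi / 4)) * h

lemma norm_scaledTail_le {δ T s : ℝ} (h1 : 1 / 2 < δ) (h2 : δ < 3 / 4) (hT : 0 < T) (hs : 0 < s) :
    ‖scaledTail T s‖ ≤ 2 ^ δ * L δ * T ^ (-δ) * s ^ (1 - 2 * δ) := by
  have hT2 : 0 < T / 2 := by positivity
  have hsq : 0 < Real.sqrt (T / 2) := Real.sqrt_pos.2 hT2
  rw [scaledTail, norm_mul, norm_real, Real.norm_of_nonneg (Real.sqrt_nonneg _)]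
  have h := norm_fresnelTail_le h1 h2 (mul_pos hsq hs)
  refine (mul_le_mul_of_nonneg_left h (Real.sqrt_nonneg _)).trans (le_of_eq ?_)
  have h3 : Real.sqrt (2 / T) = (T / 2) ^ (-(1 / 2) : ℝ) := by
    rw [Real.rpow_neg hT2.le, ← Real.sqrt_eq_rpow, ← Real.sqrt_inv, inv_div]
  have h4 : Real.sqrt (T / 2) ^ (1 - 2 * δ) = (T / 2) ^ (1 / 2 - δ) := by
    rw [Real.sqrt_eq_rpow, ← Real.rpow_mul hT2.le]; ring_nf
  have h5 : (T / 2) ^ (-(1 / 2) : ℝ) * (T / 2) ^ (1 / 2 - δ) = 2 ^ δ * T ^ (-δ) := by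
    rw [← Real.rpow_add hT2, show -(1 / 2) + (1 / 2 - δ) = -δ by ring,
      Real.div_rpow hT.le zero_le_two, Real.rpow_neg zero_le_two, div_inv_eq_mul, mul_comm]
  rw [Real.mul_rpow hsq.le hs.le, h3, h4]
  linear_combination L δ * s ^ (1 - 2 * δ) * h5

/-- Cauchy–Schwarz; `δ < 3/4` makes the squared weight `s^(2-4δ)` integrable at `0`. -/
lemma integral_norm_mul_rpow_le {δ b : ℝ} (h2 : δ < 3 / 4) (hb : 0 ≤ b)
    {h : ℝ → ℂ} (hh : Continuous h) :
    IntervalIntegrable (fun s : ℝ => ‖h s‖ * s ^ (1 - 2 * δ)) volume 0 b ∧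
    ∫ s in (0 : ℝ)..b, ‖h s‖ * s ^ (1 - 2 * δ) ≤
      b ^ ((3 - 4 * δ) / 2) / Real.sqrt (3 - 4 * δ) * Real.sqrt (∫ s in (0 : ℝ)..b, ‖h s‖ ^ 2) := by
  have hint (r : ℝ) (hr : -1 < r) : IntegrableOn (fun s : ℝ => s ^ r) (Set.Ioc 0 b) :=
    (intervalIntegrable_iff_integrableOn_Ioc_of_le hb).1
      (intervalIntegral.intervalIntegrable_rpow' hr)
  have hsq : ∀ s ∈ Set.Ioc 0 b, (s ^ (1 - 2 * δ)) ^ 2 = s ^ (2 - 4 * δ) := fun s hs => by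
    rw [← Real.rpow_natCast, ← Real.rpow_mul hs.1.le]; push_cast; ring_nf
  have hmeas : Measurable fun s : ℝ => s ^ (1 - 2 * δ) := by fun_prop
  have hL2 : MemLp (fun s : ℝ => s ^ (1 - 2 * δ)) 2 (volume.restrict (Set.Ioc 0 b)) := by
    refine (memLp_two_iff_integrable_sq hmeas.aestronglyMeasurable).2 ?_
    exact (hint (2 - 4 * δ) (by linarith)).congr_fun (fun s hs => (hsq s hs).symm)
      measurableSet_Ioc
  have hh2 : MemLp (fun s : ℝ => ‖h s‖) 2 (volume.restrict (Set.Ioc 0 b)) := by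
    refine (memLp_two_iff_integrable_sq (by fun_prop)).2 ?_
    have : IntegrableOn (fun s : ℝ => ‖h s‖ ^ 2) (Set.Icc 0 b) :=
      (by fun_prop : Continuous fun s : ℝ => ‖h s‖ ^ 2).continuousOn.integrableOn_compact
        isCompact_Icc
    exact this.mono_set Set.Ioc_subset_Icc_self
  refine ⟨(intervalIntegrable_iff_integrableOn_Ioc_of_le hb).2 (hh2.integrable_mul hL2), ?_⟩
  have hCS := integral_mul_le_Lp_mul_Lq_of_nonneg (μ := volume.restrict (Set.Ioc 0 b))
    Real.HolderConjugate.two_two (f := fun s => ‖h s‖) (g := fun s => s ^ (1 - 2 * δ))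
    (Filter.Eventually.of_forall fun s => norm_nonneg _)
    ((ae_restrict_iff' measurableSet_Ioc).2 (Filter.Eventually.of_forall fun s hs =>
      Real.rpow_nonneg hs.1.le _)) (by simpa using hh2) (by simpa using hL2)
  have hI : ∫ s in Set.Ioc 0 b, (s ^ (1 - 2 * δ)) ^ 2 = b ^ (3 - 4 * δ) / (3 - 4 * δ) := by
    rw [setIntegral_congr_fun measurableSet_Ioc hsq, ← intervalIntegral.integral_of_le hb,
      integral_rpow (Or.inl (by linarith)), Real.zero_rpow (by linarith)]
    ring_nf
  simp only [Real.rpow_two] at hCS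
  rw [hI, ← Real.sqrt_eq_rpow, ← Real.sqrt_eq_rpow, Real.sqrt_div (Real.rpow_nonneg hb _)] at hCS
  rw [intervalIntegral.integral_of_le hb, intervalIntegral.integral_of_le hb]
  refine hCS.trans (le_of_eq ?_)
  have : Real.sqrt (b ^ (3 - 4 * δ)) = b ^ ((3 - 4 * δ) / 2) := by
    rw [Real.sqrt_eq_rpow, ← Real.rpow_mul hb]; ring_nf
  rw [this, mul_comm]

/-- Integration by parts against `scaledTail`: the boundary term at `b` vanishes with `g`, the one
at `0` is the subtracted main term. -/
lemma norm_integral_sub_scaledTail_le {δ T b : ℝ} (h1 : 1 / 2 < δ) (h2 : δ < 3 / 4) (hT : 0 < T)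
    (hb : 0 ≤ b) {g g' : ℝ → ℂ} (hg : ∀ p, HasDerivAt g (g' p) p) (hg' : Continuous g')
    (hgb : g b = 0) :
    ‖(∫ s in (0 : ℝ)..b, g s * exp (-I * (T / 2) * (s : ℂ) ^ 2)) - g 0 * scaledTail T 0‖ ≤
      2 ^ δ * L δ * T ^ (-δ) * (b ^ ((3 - 4 * δ) / 2) / Real.sqrt (3 - 4 * δ) *
        Real.sqrt (∫ s in (0 : ℝ)..b, ‖g' s‖ ^ 2)) := by
  have hibp := intervalIntegral.integral_mul_deriv_eq_deriv_mul (a := 0) (b := b)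
    (fun x _ => hg x) (fun x _ => hasDerivAt_scaledTail hT x) (hg'.intervalIntegrable _ _)
    ((by fun_prop : Continuous fun s : ℝ =>
      -exp (-I * (T / 2) * (s : ℂ) ^ 2)).intervalIntegrable _ _)
  simp only [mul_neg, intervalIntegral.integral_neg, hgb, zero_mul] at hibp
  have heq : (∫ s in (0 : ℝ)..b, g s * exp (-I * (T / 2) * (s : ℂ) ^ 2)) - g 0 * scaledTail T 0 =
      ∫ s in (0 : ℝ)..b, g' s * scaledTail T s := by
    linear_combination -hibp
  obtain ⟨hi, hle⟩ := integral_norm_mul_rpow_le h2 hb hg'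
  rw [heq]
  have hnn : 0 ≤ 2 ^ δ * L δ * T ^ (-δ) := by unfold L; positivity
  calc _ ≤ ∫ s in (0 : ℝ)..b, 2 ^ δ * L δ * T ^ (-δ) * (‖g' s‖ * s ^ (1 - 2 * δ)) := by
        refine intervalIntegral.norm_integral_le_of_norm_le hb
          (Filter.Eventually.of_forall fun s hs => ?_) (hi.const_mul _)
        rw [norm_mul]
        have := norm_scaledTail_le h1 h2 hT hs.1
        calc _ ≤ ‖g' s‖ * (2 ^ δ * L δ * T ^ (-δ) * s ^ (1 - 2 * δ)) := by gcongr
          _ = _ := by ring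
    _ ≤ _ := by
        rw [intervalIntegral.integral_const_mul]
        exact mul_le_mul_of_nonneg_left hle hnn

/-- Stationary phase with the remainder controlled by the `L²` norm of the derivative. -/
lemma norm_integral_sub_stationary_le_of_pos {δ T v q₁ q₂ : ℝ} (h1 : 1 / 2 < δ) (h2 : δ < 3 / 4)
    (hT : 0 < T) (hv₁ : q₁ ≤ v) (hv₂ : v ≤ q₂) {g g' : ℝ → ℂ}
    (hg : ∀ p, HasDerivAt g (g' p) p) (hg' : Continuous g')
    (hsupp : ∀ p ∉ Set.Ioo q₁ q₂, g p = 0) (hint : Integrable fun p => ‖g' p‖ ^ 2) :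
    ‖(∫ p, g p * exp (-I * (T / 2) * ((p : ℂ) - v) ^ 2)) - g v * (2 * scaledTail T 0)‖ ≤
      2 * (2 ^ δ * L δ * T ^ (-δ) * ((q₂ - q₁) ^ ((3 - 4 * δ) / 2) / Real.sqrt (3 - 4 * δ) *
        Real.sqrt (∫ p, ‖g' p‖ ^ 2))) := by
  set e : ℝ → ℂ := fun p => exp (-I * (T / 2) * ((p : ℂ) - v) ^ 2) with he
  have hgc : Continuous g := continuous_iff_continuousAt.2 fun p => (hg p).continuousAt
  have hec : Continuous e := by fun_prop
  have hq : q₁ ≤ q₂ := hv₁.trans hv₂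
  have hfull : ∫ p, g p * e p = (∫ p in q₁..v, g p * e p) + ∫ p in v..q₂, g p * e p := by
    have hi (a b : ℝ) : IntervalIntegrable (fun p => g p * e p) volume a b :=
      (hgc.mul hec).intervalIntegrable _ _
    rw [intervalIntegral.integral_add_adjacent_intervals (hi _ _) (hi _ _),
      intervalIntegral.integral_of_le hq, setIntegral_eq_integral_of_forall_compl_eq_zero]
    intro p hp
    rw [hsupp p (fun h => hp (Set.Ioo_subset_Ioc_self h)), zero_mul]
  have hR : ∫ p in v..q₂, g p * e p =
      ∫ s in (0 : ℝ)..(q₂ - v), g (s + v) * exp (-I * (T / 2) * (s : ℂ) ^ 2) := by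
    have := intervalIntegral.integral_comp_add_right (a := 0) (b := q₂ - v)
      (fun p => g p * e p) v
    rw [zero_add, sub_add_cancel] at this
    rw [← this]
    simp [he]
  -- Reflection about `v` turns the left half into the same one-sided integral, so both halves
  -- contribute `scaledTail T 0`.
  have hL : ∫ p in q₁..v, g p * e p =
      ∫ s in (0 : ℝ)..(v - q₁), g (v - s) * exp (-I * (T / 2) * (s : ℂ) ^ 2) := by
    have := intervalIntegral.integral_comp_sub_left (a := 0) (b := v - q₁)
      (fun p => g p * e p) v
    rw [sub_zero, sub_sub_cancel] at this
    rw [← this]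
    simp [he]
  have hnn : 0 ≤ 2 ^ δ * L δ * T ^ (-δ) := by unfold FreeSchrodinger.L; positivity
  have bR := norm_integral_sub_scaledTail_le h1 h2 hT (sub_nonneg.2 hv₂)
    (g := fun s => g (s + v)) (g' := fun s => g' (s + v))
    (fun p => (hg (p + v)).comp_add_const p v) (by fun_prop)
    (by simpa using hsupp q₂ (by simp))
  have bL := norm_integral_sub_scaledTail_le h1 h2 hT (sub_nonneg.2 hv₁)
    (g := fun s => g (v - s)) (g' := fun s => -g' (v - s))
    (fun p => (hg (v - p)).comp_const_sub v p) (by fun_prop)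
    (by simpa using hsupp q₁ (by simp))
  have iR : ∫ s in (0 : ℝ)..(q₂ - v), ‖g' (s + v)‖ ^ 2 ≤ ∫ p, ‖g' p‖ ^ 2 := by
    rw [intervalIntegral.integral_comp_add_right (fun p => ‖g' p‖ ^ 2), zero_add, sub_add_cancel,
      intervalIntegral.integral_of_le hv₂]
    exact setIntegral_le_integral hint (Filter.Eventually.of_forall fun p => sq_nonneg _)
  have iL : ∫ s in (0 : ℝ)..(v - q₁), ‖-g' (v - s)‖ ^ 2 ≤ ∫ p, ‖g' p‖ ^ 2 := by
    simp only [norm_neg]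
    rw [intervalIntegral.integral_comp_sub_left (fun p => ‖g' p‖ ^ 2), sub_zero, sub_sub_cancel,
      intervalIntegral.integral_of_le hv₁]
    exact setIntegral_le_integral hint (Filter.Eventually.of_forall fun p => sq_nonneg _)
  have hexp : 0 ≤ (3 - 4 * δ) / 2 := by linarith
  -- Each half is bounded using the full width and the full `L²` norm, hence the factor 2 in the
  -- conclusion.
  have bound (d : ℝ) (J : ℝ) (hd0 : 0 ≤ d) (hd : d ≤ q₂ - q₁) (hJ : J ≤ ∫ p, ‖g' p‖ ^ 2) :
      2 ^ δ * FreeSchrodinger.L δ * T ^ (-δ) *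
        (d ^ ((3 - 4 * δ) / 2) / Real.sqrt (3 - 4 * δ) * Real.sqrt J) ≤
      2 ^ δ * FreeSchrodinger.L δ * T ^ (-δ) * ((q₂ - q₁) ^ ((3 - 4 * δ) / 2) /
        Real.sqrt (3 - 4 * δ) * Real.sqrt (∫ p, ‖g' p‖ ^ 2)) := by
    refine mul_le_mul_of_nonneg_left ?_ hnn
    gcongr
  have bR' := bR.trans (bound _ _ (by linarith) (by linarith) iR)
  have bL' := bL.trans (bound _ _ (by linarith) (by linarith) iL)
  simp only [zero_add] at bR'
  simp only [sub_zero] at bL'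
  rw [hfull, hR, hL, two_mul (2 ^ δ * _ * _ * _)]
  refine le_trans (le_of_eq ?_) ((norm_add_le _ _).trans (add_le_add bL' bR'))
  congr 1
  ring

lemma norm_integral_sub_stationary_le {δ T v q₁ q₂ : ℝ} (h1 : 1 / 2 < δ) (h2 : δ < 3 / 4)
    (hT : T ≠ 0) (hv₁ : q₁ ≤ v) (hv₂ : v ≤ q₂) {g g' : ℝ → ℂ}
    (hg : ∀ p, HasDerivAt g (g' p) p) (hg' : Continuous g')
    (hsupp : ∀ p ∉ Set.Ioo q₁ q₂, g p = 0) (hint : Integrable fun p => ‖g' p‖ ^ 2) :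
    ‖(∫ p, g p * exp (-I * (T / 2) * ((p : ℂ) - v) ^ 2)) -
        g v * (Real.sqrt (2 * Real.pi) * exp (-(Real.sign T : ℂ) * I * (Real.pi / 4)) *
          ((|T| ^ (-(1 / 2) : ℝ) : ℝ) : ℂ))‖ ≤
      2 ^ (δ + 1) * L δ * |T| ^ (-δ) * ((q₂ - q₁) ^ ((3 - 4 * δ) / 2) / Real.sqrt (3 - 4 * δ) *
        Real.sqrt (∫ p, ‖g' p‖ ^ 2)) := by
  have h2d : (2 : ℝ) ^ (δ + 1) = 2 * 2 ^ δ := by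
    rw [Real.rpow_add_one (by norm_num), mul_comm]
  rcases hT.lt_or_gt with hT | hT
  -- For `T < 0`, complex conjugation of amplitude and phase reduces to `-T > 0`.
  · have key := norm_integral_sub_stationary_le_of_pos h1 h2 (neg_pos.2 hT) hv₁ hv₂
      (g := fun p => (starRingEnd ℂ) (g p)) (g' := fun p => (starRingEnd ℂ) (g' p))
      (fun p => (hg p).star) (by fun_prop) (fun p hp => by simp [hsupp p hp])
      (by simpa using hint)
    rw [scaledTail_zero (neg_pos.2 hT), ← norm_conj, map_sub, ← integral_conj] at key
    simp only [map_mul, map_neg, map_sub, map_pow, map_div₀, conj_I, conj_ofReal, map_ofNat,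
      conj_conj, ← exp_conj, norm_conj, neg_neg] at key
    rw [abs_of_neg hT, Real.sign_of_neg hT, h2d]
    refine le_trans (le_of_eq ?_) (key.trans (le_of_eq (by ring)))
    have e1 (p : ℝ) : I * (((-T : ℝ) : ℂ) / 2) * ((p : ℂ) - v) ^ 2 =
        -I * (T / 2) * ((p : ℂ) - v) ^ 2 := by push_cast; ring
    have e2 : -((-1 : ℝ) : ℂ) * I * (Real.pi / 4) = I * (Real.pi / 4) := by push_cast; ring
    simp only [e1, e2]
  · have key := norm_integral_sub_stationary_le_of_pos h1 h2 hT hv₁ hv₂ hg hg' hsupp hint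
    rw [scaledTail_zero hT] at key
    rw [abs_of_pos hT, Real.sign_of_pos hT, h2d]
    refine le_trans (le_of_eq ?_) (key.trans (le_of_eq (by ring)))
    simp

/-! ### Non-stationary phase -/

lemma integral_norm_le_sqrt_mul_sqrt {a b : ℝ} (hab : a ≤ b) {h : ℝ → ℂ} (hh : Continuous h) :
    ∫ p in a..b, ‖h p‖ ≤ Real.sqrt (b - a) * Real.sqrt (∫ p in a..b, ‖h p‖ ^ 2) := by
  -- At `δ = 1/2` the weight is constant and the weighted inequality becomes plain Cauchy–Schwarz.
  have key := (integral_norm_mul_rpow_le (δ := 1 / 2) (by norm_num) (sub_nonneg.2 hab)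
    (h := fun s => h (s + a)) (by fun_prop)).2
  have e : (3 - 4 * (1 / 2) : ℝ) = 1 := by norm_num
  simp only [e, mul_one_div_cancel (two_ne_zero' ℝ), sub_self, Real.rpow_zero, mul_one,
    Real.sqrt_one, div_one, ← Real.sqrt_eq_rpow] at key
  rw [intervalIntegral.integral_comp_add_right (fun p => ‖h p‖),
    intervalIntegral.integral_comp_add_right (fun p => ‖h p‖ ^ 2), zero_add, sub_add_cancel] at key
  exact key

/-- Of the two boundary values of `-(p - v)⁻¹`, one has a favourable sign and is dropped; the bound
is therefore independent of the interval's length. -/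
lemma integral_inv_sq_le {p₁ p₂ v d : ℝ} (hp : p₁ ≤ p₂) (hd : 0 < d)
    (hv : v ≤ p₁ - d ∨ p₂ + d ≤ v) :
    ∫ p in p₁..p₂, ((p - v) ^ 2)⁻¹ ≤ d⁻¹ := by
  have hne : ∀ p ∈ Set.uIcc p₁ p₂, p - v ≠ 0 := fun p hpm => by
    rw [Set.uIcc_of_le hp] at hpm
    rcases hv with h | h
    · have := hpm.1; exact (by linarith : 0 < p - v).ne'
    · have := hpm.2; exact (by linarith : p - v < 0).ne
  have hderiv : ∀ p ∈ Set.uIcc p₁ p₂,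
      HasDerivAt (fun p => -(p - v)⁻¹) (((p - v) ^ 2)⁻¹) p := fun p hpm => by
    have := (((hasDerivAt_id p).sub_const v).inv (hne p hpm)).neg
    convert! this using 1
    simp [neg_div]
  rw [intervalIntegral.integral_eq_sub_of_hasDerivAt hderiv
    (ContinuousOn.intervalIntegrable (ContinuousOn.inv₀ (by fun_prop)
      fun p hpm => pow_ne_zero 2 (hne p hpm)))]
  rcases hv with h | h
  · have h1 : 0 ≤ (p₂ - v)⁻¹ := inv_nonneg.2 (by linarith)
    have h2 : (p₁ - v)⁻¹ ≤ d⁻¹ := inv_anti₀ hd (by linarith)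
    linarith
  · have h1 : 0 ≤ (v - p₁)⁻¹ := inv_nonneg.2 (by linarith)
    have h2 : (v - p₂)⁻¹ ≤ d⁻¹ := inv_anti₀ hd (by linarith)
    rw [← inv_neg, ← inv_neg, neg_sub, neg_sub]
    linarith [show (p₁ - v)⁻¹ = -(v - p₁)⁻¹ by rw [← inv_neg, neg_sub]]

/-- Non-stationary phase: decay of order `|T|⁻¹` away from the support of the amplitude. -/
lemma norm_integral_nonstationary_le {T v p₁ p₂ d M : ℝ} (hT : T ≠ 0) (hp : p₁ ≤ p₂) (hd : 0 < d)
    (hv : v ≤ p₁ - d ∨ p₂ + d ≤ v) {g g' : ℝ → ℂ}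
    (hg : ∀ p, HasDerivAt g (g' p) p) (hg' : Continuous g')
    (hsupp : ∀ p ∉ Set.Ioo p₁ p₂, g p = 0) (hint : Integrable fun p => ‖g' p‖ ^ 2)
    (hM : ∀ p, ‖g p‖ ≤ M) :
    ‖∫ p, g p * exp (-I * (T / 2) * ((p : ℂ) - v) ^ 2)‖ ≤
      |T|⁻¹ * (d⁻¹ * (Real.sqrt (p₂ - p₁) * Real.sqrt (∫ p, ‖g' p‖ ^ 2)) + M * d⁻¹) := by
  have hgc : Continuous g := continuous_iff_continuousAt.2 fun p => (hg p).continuousAt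
  have hdist : ∀ p ∈ Set.uIcc p₁ p₂, d ≤ |p - v| := fun p hpm => by
    rw [Set.uIcc_of_le hp] at hpm
    rcases hv with h | h
    · have := hpm.1; exact le_trans (by linarith) (le_abs_self _)
    · have := hpm.2; exact le_trans (by linarith) (neg_le_abs _)
  have hne : ∀ p ∈ Set.uIcc p₁ p₂, p - v ≠ 0 := fun p hpm =>
    abs_pos.1 (hd.trans_le (hdist p hpm))
  have hneC : ∀ p ∈ Set.uIcc p₁ p₂, (p : ℂ) - v ≠ 0 := fun p hpm => by
    exact_mod_cast hne p hpm
  set e : ℝ → ℂ := fun p => exp (-I * (T / 2) * ((p : ℂ) - v) ^ 2) with he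
  have hec : Continuous e := by fun_prop
  have hc (p : ℝ) : HasDerivAt (fun p : ℝ => (p : ℂ) - v) 1 p := by
    simpa using (ofRealCLM.hasDerivAt (x := p)).sub_const (v : ℂ)
  have hw : ∀ p ∈ Set.uIcc p₁ p₂, HasDerivAt (fun p : ℝ => g p / ((p : ℂ) - v))
      (g' p / ((p : ℂ) - v) - g p / ((p : ℂ) - v) ^ 2) p := fun p hpm => by
    convert! (hg p).div (hc p) (hneC p hpm) using 1
    have := hneC p hpm
    field_simp
  have he' (p : ℝ) : HasDerivAt e (-I * T * (((p : ℂ) - v) * e p)) p := by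
    convert! (((hc p).pow 2).const_mul (-I * (T / 2))).cexp using 1
    simp [he]
    ring
  have hcw : ContinuousOn (fun p : ℝ => g' p / ((p : ℂ) - v) - g p / ((p : ℂ) - v) ^ 2)
      (Set.uIcc p₁ p₂) :=
    (hg'.continuousOn.div (by fun_prop) hneC).sub
      (hgc.continuousOn.div (by fun_prop) fun p hpm => pow_ne_zero 2 (hneC p hpm))
  -- As `e' = -iT(p - v)e`, writing `g e` as `g/(p - v)` times `e'/(-iT)` moves the derivative onto
  -- `g/(p - v)`; `g` vanishes at both endpoints.
  have hibp := intervalIntegral.integral_mul_deriv_eq_deriv_mul (a := p₁) (b := p₂)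
    hw (fun p _ => he' p) hcw.intervalIntegrable
    ((by fun_prop : Continuous fun p : ℝ =>
      -I * T * (((p : ℂ) - v) * e p)).intervalIntegrable _ _)
  have hTC : (T : ℂ) ≠ 0 := by exact_mod_cast hT
  have hfull : ∫ p, g p * e p = ∫ p in p₁..p₂, g p * e p := by
    rw [intervalIntegral.integral_of_le hp, setIntegral_eq_integral_of_forall_compl_eq_zero]
    intro p hpm
    rw [hsupp p (fun h => hpm (Set.Ioo_subset_Ioc_self h)), zero_mul]
  have heq : ∫ p in p₁..p₂, g p / ((p : ℂ) - v) * (-I * T * (((p : ℂ) - v) * e p)) =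
      -I * T * ∫ p in p₁..p₂, g p * e p := by
    rw [← intervalIntegral.integral_const_mul]
    refine intervalIntegral.integral_congr fun p hpm => ?_
    have := hneC p hpm
    field_simp
  rw [heq, hsupp p₁ (by simp), hsupp p₂ (by simp)] at hibp
  have hnorm := congrArg norm hibp
  simp only [zero_div, zero_mul, sub_self, zero_sub, norm_neg, norm_mul, norm_I, one_mul,
    norm_real, Real.norm_eq_abs] at hnorm
  rw [hfull, ← div_eq_inv_mul, le_div_iff₀ (abs_pos.2 hT), mul_comm, hnorm]
  have hcinv : IntervalIntegrable (fun p : ℝ => ((p - v) ^ 2)⁻¹) volume p₁ p₂ :=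
    ContinuousOn.intervalIntegrable (ContinuousOn.inv₀ (by fun_prop)
      fun p hpm => pow_ne_zero 2 (hne p hpm))
  have hcn : IntervalIntegrable (fun p : ℝ => ‖g' p‖) volume p₁ p₂ :=
    hg'.norm.intervalIntegrable _ _
  have hM0 : 0 ≤ M := (norm_nonneg _).trans (hM 0)
  calc _ ≤ ∫ p in p₁..p₂, (d⁻¹ * ‖g' p‖ + M * ((p - v) ^ 2)⁻¹) := by
        refine intervalIntegral.norm_integral_le_of_norm_le hp
          (Filter.Eventually.of_forall fun p hpm => ?_) ((hcn.const_mul _).add (hcinv.const_mul _))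
        have hpm' : p ∈ Set.uIcc p₁ p₂ := by
          rw [Set.uIcc_of_le hp]; exact Set.Ioc_subset_Icc_self hpm
        have hen : ‖e p‖ = 1 := by
          have : -I * ((T : ℂ) / 2) * ((p : ℂ) - v) ^ 2 =
              ((-(T / 2 * (p - v) ^ 2) : ℝ) : ℂ) * I := by push_cast; ring
          rw [he]; dsimp only
          rw [this, norm_exp_ofReal_mul_I]
        have hnv : ‖(p : ℂ) - v‖ = |p - v| := by
          rw [← ofReal_sub, norm_real, Real.norm_eq_abs]
        rw [norm_mul, hen, mul_one]
        refine (norm_sub_le _ _).trans (add_le_add ?_ ?_)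
        · rw [norm_div, hnv, div_eq_inv_mul]
          exact mul_le_mul_of_nonneg_right (inv_anti₀ hd (hdist p hpm')) (norm_nonneg _)
        · rw [norm_div, norm_pow, hnv, sq_abs, div_eq_mul_inv]
          exact mul_le_mul_of_nonneg_right (hM p) (by positivity)
    _ = d⁻¹ * (∫ p in p₁..p₂, ‖g' p‖) + M * ∫ p in p₁..p₂, ((p - v) ^ 2)⁻¹ := by
        rw [intervalIntegral.integral_add (hcn.const_mul _) (hcinv.const_mul _),
          intervalIntegral.integral_const_mul, intervalIntegral.integral_const_mul]
    _ ≤ _ := by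
        have h1 : ∫ p in p₁..p₂, ‖g' p‖ ^ 2 ≤ ∫ p, ‖g' p‖ ^ 2 := by
          rw [intervalIntegral.integral_of_le hp]
          exact setIntegral_le_integral hint (Filter.Eventually.of_forall fun p => sq_nonneg _)
        have h2 := integral_norm_le_sqrt_mul_sqrt hp hg'
        have h3 := integral_inv_sq_le hp hd hv
        gcongr
        exact h2.trans (by gcongr)

/-! ### Fourier synthesis and Plancherel -/

/-- Fourier synthesis `(1/2π) ∫ g(p) e^{ixp} dp`. -/
def synth (g : ℝ → ℂ) (x : ℝ) : ℂ := (1 / (2 * Real.pi) : ℂ) * ∫ p : ℝ, g p * exp (I * x * p)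

lemma fourier_eq_fourierTransform (u : ℝ → ℂ) (p : ℝ) :
    fourier u p = 𝓕 u (p / (2 * Real.pi)) := by
  rw [Real.fourier_eq', fourier]
  refine integral_congr_ae (Filter.Eventually.of_forall fun x => ?_)
  have : ((-2 * Real.pi * inner ℝ x (p / (2 * Real.pi)) : ℝ) : ℂ) * I = -(I * x * p) := by
    have h : -2 * Real.pi * inner ℝ x (p / (2 * Real.pi)) = -(x * p) := by
      have := Real.pi_ne_zero
      simp only [RCLike.inner_apply, conj_trivial]
      field_simp
    rw [h]; push_cast; ring
  dsimp only
  rw [this, smul_eq_mul, mul_comm]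

lemma synth_eq_fourierInv (g : ℝ → ℂ) (x : ℝ) :
    synth g x = 𝓕⁻ (fun ξ => g (2 * Real.pi * ξ)) x := by
  have h := Measure.integral_comp_mul_left (fun p : ℝ => g p * exp (I * x * p)) (2 * Real.pi)
  rw [abs_of_pos (by positivity)] at h
  rw [Real.fourierInv_eq', synth]
  have : ∀ ξ : ℝ, exp (((2 * Real.pi * inner ℝ ξ x : ℝ) : ℂ) * I) • g (2 * Real.pi * ξ) =
      g (2 * Real.pi * ξ) * exp (I * x * ((2 * Real.pi * ξ : ℝ) : ℂ)) := fun ξ => by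
    rw [smul_eq_mul, mul_comm]
    congr 2
    simp only [RCLike.inner_apply, conj_trivial]
    push_cast
    ring
  simp only [this]
  rw [h, real_smul]
  push_cast
  ring

lemma synth_fourier (u : 𝓢(ℝ, ℂ)) (x : ℝ) : synth (fourier u) x = u x := by
  rw [synth_eq_fourierInv]
  have : (fun ξ => fourier u (2 * Real.pi * ξ)) = 𝓕 (u : ℝ → ℂ) := by
    ext ξ
    rw [fourier_eq_fourierTransform, mul_div_cancel_left₀ _ (by positivity)]
  rw [this, ← SchwartzMap.fourier_coe, ← SchwartzMap.fourierInv_coe,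
    FourierPair.fourierInv_fourier_eq]

lemma contDiff_fourier (u : 𝓢(ℝ, ℂ)) : ContDiff ℝ ∞ (fourier u) := by
  have : fourier u = fun p => (𝓕 u) (p / (2 * Real.pi)) := by
    ext p
    rw [fourier_eq_fourierTransform, SchwartzMap.fourier_coe]
  rw [this]
  have h : ContDiff ℝ ∞ ((𝓕 u : 𝓢(ℝ, ℂ)) : ℝ → ℂ) := (𝓕 u).smooth ⊤
  exact h.comp (contDiff_id.div_const _)

lemma norm_fourier_le (u : ℝ → ℂ) (p : ℝ) : ‖fourier u p‖ ≤ ∫ x, ‖u x‖ := by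
  refine (norm_integral_le_integral_norm _).trans (le_of_eq ?_)
  refine integral_congr_ae (Filter.Eventually.of_forall fun x => ?_)
  have : -(I * x * p) = ((-(x * p) : ℝ) : ℂ) * I := by push_cast; ring
  dsimp only
  rw [norm_mul, this, norm_exp_ofReal_mul_I, mul_one]

/-- Plancherel's theorem for Fourier synthesis. -/
lemma plancherel_synth {g : ℝ → ℂ} (hg : ContDiff ℝ ∞ g) (hc : HasCompactSupport g) :
    Integrable (fun x => ‖synth g x‖ ^ 2) ∧
      ∫ x, ‖synth g x‖ ^ 2 = (2 * Real.pi)⁻¹ * ∫ p, ‖g p‖ ^ 2 := by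
  have h2pi : (2 * Real.pi) ≠ 0 := by positivity
  have hc' : HasCompactSupport fun ξ => g (2 * Real.pi * ξ) :=
    hc.comp_homeomorph (Homeomorph.mulLeft₀ (2 * Real.pi) h2pi)
  set G : 𝓢(ℝ, ℂ) := hc'.toSchwartzMap (hg.comp (by fun_prop)) with hG
  have hsyn : ∀ x, synth g x = (𝓕⁻ G) x := fun x => by
    rw [synth_eq_fourierInv, SchwartzMap.fourierInv_coe]
    rfl
  simp only [hsyn]
  refine ⟨((memLp_two_iff_integrable_sq_norm ((𝓕⁻ G).continuous.aestronglyMeasurable)).1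
    ((𝓕⁻ G).memLp 2)), ?_⟩
  rw [← SchwartzMap.integral_norm_sq_fourier, FourierInvPair.fourier_fourierInv_eq]
  have h := Measure.integral_comp_mul_left (fun p : ℝ => ‖g p‖ ^ 2) (2 * Real.pi)
  rw [abs_of_pos (by positivity), smul_eq_mul] at h
  exact h

/-- Integration by parts in `p`; compact support removes the boundary terms. -/
lemma mul_synth {g : ℝ → ℂ} (hg : ContDiff ℝ ∞ g) (hc : HasCompactSupport g) (x : ℝ) :
    x * synth g x = synth (fun p => I * deriv g p) x := by
  have hd : Differentiable ℝ g := hg.differentiable (by simp)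
  have hcd : Continuous (deriv g) := hg.continuous_deriv (by simp)
  have he (p : ℝ) : HasDerivAt (fun p : ℝ => exp (I * x * p)) (exp (I * x * p) * (I * x)) p := by
    have := ((ofRealCLM.hasDerivAt (x := p)).const_mul (I * x)).cexp
    simpa using this
  have hec : Continuous fun p : ℝ => exp (I * x * p) := by fun_prop
  have h := integral_mul_deriv_eq_deriv_mul_of_integrable (u := g)
    (v := fun p : ℝ => exp (I * x * p)) (fun p _ => (hd p).hasDerivAt) (fun p _ => he p)
    ((hg.continuous.mul (hec.mul_const _)).integrable_of_hasCompactSupport hc.mul_right)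
    ((hcd.mul hec).integrable_of_hasCompactSupport hc.deriv.mul_right)
    ((hg.continuous.mul hec).integrable_of_hasCompactSupport hc.mul_right)
  have h1 : ∫ p, g p * (exp (I * x * p) * (I * x)) = I * x * ∫ p, g p * exp (I * x * p) := by
    rw [← integral_const_mul]
    congr 1; ext p; ring
  have h2 : ∫ p, I * deriv g p * exp (I * x * p) = I * ∫ p, deriv g p * exp (I * x * p) := by
    rw [← integral_const_mul]
    congr 1; ext p; ring
  rw [h1] at h
  rw [synth, synth, h2]
  linear_combination (-I * (1 / (2 * Real.pi) : ℂ)) * h +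
    (1 / (2 * Real.pi) : ℂ) * (x * ∫ p, g p * exp (I * x * p)) * I_sq

/-- Serves for both variables: `a p = p` for space and `a p = -p²/2` for time. -/
lemma hasDerivAt_integral_phase {h : ℝ → ℂ} (hh : Continuous h) (hc : HasCompactSupport h)
    {a : ℝ → ℝ} (ha : Continuous a) (s : ℝ) :
    HasDerivAt (fun s : ℝ => ∫ p, h p * exp (I * s * a p))
      (∫ p, h p * (I * a p) * exp (I * s * a p)) s := by
  refine (hasDerivAt_integral_of_dominated_loc_of_deriv_le (s := Set.univ)
    (bound := fun p => ‖h p * (I * a p)‖)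
    (F := fun (s : ℝ) p => h p * exp (I * s * a p))
    (F' := fun (s : ℝ) p => h p * (I * a p) * exp (I * s * a p)) Filter.univ_mem
    (Filter.Eventually.of_forall fun z => Continuous.aestronglyMeasurable (by fun_prop))
    (Continuous.integrable_of_hasCompactSupport (by fun_prop) hc.mul_right)
    (Continuous.aestronglyMeasurable (by fun_prop))
    (Filter.Eventually.of_forall fun p z _ => ?_)
    (Continuous.integrable_of_hasCompactSupport (by fun_prop) hc.mul_right).norm
    (Filter.Eventually.of_forall fun p z _ => ?_)).2
  · have : I * z * a p = ((z * a p : ℝ) : ℂ) * I := by push_cast; ring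
    rw [norm_mul _ (exp _), this, norm_exp_ofReal_mul_I, mul_one]
  · have h1 : HasDerivAt (fun z : ℝ => I * (z : ℂ) * a p) (I * a p) z := by
      simpa using ((ofRealCLM.hasDerivAt (x := z)).const_mul I).mul_const (a p : ℂ)
    convert! h1.cexp.const_mul (h p) using 1
    ring

lemma hasDerivAt_synth {g : ℝ → ℂ} (hg : Continuous g) (hc : HasCompactSupport g) (x : ℝ) :
    HasDerivAt (synth g) (synth (fun p => g p * (I * p)) x) x :=
  (hasDerivAt_integral_phase hg hc continuous_id x).const_mul _

lemma continuous_synth {g : ℝ → ℂ} (hg : Continuous g) (hc : HasCompactSupport g) :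
    Continuous (synth g) :=
  continuous_iff_continuousAt.2 fun x => (hasDerivAt_synth hg hc x).continuousAt

/-! ### Modulated amplitudes and the classical solution -/

/-- The amplitude `f` multiplied by the free propagator and a translation phase. -/
def modulate (f : ℝ → ℂ) (τ m p : ℝ) : ℂ :=
  f p * exp (-(1 / 2 : ℂ) * I * τ * (p : ℂ) ^ 2 + I * m * p)

lemma norm_exp_modulate (τ m p : ℝ) :
    ‖exp (-(1 / 2 : ℂ) * I * τ * (p : ℂ) ^ 2 + I * m * p)‖ = 1 := by
  have : -(1 / 2 : ℂ) * I * τ * (p : ℂ) ^ 2 + I * m * p =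
      ((-(1 / 2) * τ * p ^ 2 + m * p : ℝ) : ℂ) * I := by push_cast; ring
  rw [this, norm_exp_ofReal_mul_I]

lemma norm_modulate (f : ℝ → ℂ) (τ m p : ℝ) : ‖modulate f τ m p‖ = ‖f p‖ := by
  rw [modulate, norm_mul, norm_exp_modulate, mul_one]

lemma uS_eq_synth (u : ℝ → ℂ) (τ x : ℝ) : uS u τ x = synth (modulate (fourier u) τ 0) x := by
  simp only [uS, synth, modulate, ofReal_zero, mul_zero, zero_mul, add_zero, exp_add, mul_assoc]

lemma synth_modulate (f : ℝ → ℂ) (τ m x : ℝ) :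
    synth (modulate f τ m) x = synth (modulate f τ 0) (x + m) := by
  rw [synth, synth]
  congr 2
  ext p
  rw [modulate, modulate, mul_assoc (f p), mul_assoc (f p), ← exp_add, ← exp_add]
  congr 2
  push_cast
  ring

lemma contDiff_modulate {f : ℝ → ℂ} (hf : ContDiff ℝ ∞ f) (τ m : ℝ) :
    ContDiff ℝ ∞ (modulate f τ m) := by
  have h : ContDiff ℝ ∞ fun p : ℝ => (p : ℂ) := ofRealCLM.contDiff
  exact hf.mul (((contDiff_const.mul (h.pow 2)).add (contDiff_const.mul h)).cexp)

lemma hasCompactSupport_modulate {f : ℝ → ℂ} (hc : HasCompactSupport f) (τ m : ℝ) :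
    HasCompactSupport (modulate f τ m) := hc.mul_right

lemma deriv_modulate {f : ℝ → ℂ} (hf : Differentiable ℝ f) (τ m p : ℝ) :
    deriv (modulate f τ m) p = (deriv f p + I * ((m - τ * p : ℝ) : ℂ) * f p) *
      exp (-(1 / 2 : ℂ) * I * τ * (p : ℂ) ^ 2 + I * m * p) := by
  have h0 : HasDerivAt (fun p : ℝ => (p : ℂ)) 1 p := ofRealCLM.hasDerivAt
  have h1 := ((((h0.pow 2).const_mul (-(1 / 2 : ℂ) * I * τ)).add (h0.const_mul (I * m))).cexp)
  refine ((hf p).hasDerivAt.mul h1).deriv.trans ?_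
  simp only [Pi.add_apply, Pi.pow_apply]
  push_cast
  ring

lemma norm_deriv_modulate {f : ℝ → ℂ} (hf : Differentiable ℝ f) (τ m p : ℝ) :
    ‖deriv (modulate f τ m) p‖ = ‖deriv f p + I * ((m - τ * p : ℝ) : ℂ) * f p‖ := by
  rw [deriv_modulate hf, norm_mul, norm_exp_modulate, mul_one]

/-- The phase `e^{imp}` translates the centre `m` to the origin, where `mul_synth` and Plancherel
apply. -/
lemma integrable_and_integral_sq_sub_mul {f : ℝ → ℂ} (hf : ContDiff ℝ ∞ f)
    (hc : HasCompactSupport f) (τ m : ℝ) :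
    Integrable (fun x => (x - m) ^ 2 * ‖synth (modulate f τ 0) x‖ ^ 2) ∧
      ∫ x, (x - m) ^ 2 * ‖synth (modulate f τ 0) x‖ ^ 2 =
        (2 * Real.pi)⁻¹ * ∫ p, ‖deriv (modulate f τ m) p‖ ^ 2 := by
  have hg := contDiff_modulate hf τ m
  have hgc := hasCompactSupport_modulate hc τ m
  have hgd : ContDiff ℝ ∞ fun p => I * deriv (modulate f τ m) p :=
    contDiff_const.mul (contDiff_infty_iff_deriv.1 hg).2
  obtain ⟨hi, he⟩ := plancherel_synth hgd hgc.deriv.mul_left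
  have hpt (x : ℝ) : ‖synth (fun p => I * deriv (modulate f τ m) p) x‖ ^ 2 =
      ((x + m) - m) ^ 2 * ‖synth (modulate f τ 0) (x + m)‖ ^ 2 := by
    rw [← mul_synth hg hgc, synth_modulate, norm_mul, mul_pow, norm_real, Real.norm_eq_abs, sq_abs,
      add_sub_cancel_right]
  simp only [hpt, norm_mul, norm_I, one_mul] at hi he
  refine ⟨?_, ?_⟩
  · simpa using hi.comp_sub_right m
  · rw [← he, integral_add_right_eq_self
      (fun x => (x - m) ^ 2 * ‖synth (modulate f τ 0) x‖ ^ 2)]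

/-- Compact support allows differentiation under the integral; both sides of the equation bring down
the factor `p²/2`. -/
lemma isClassicalSolution_uS (u : 𝓢(ℝ, ℂ)) (hc : HasCompactSupport (fourier u)) :
    IsClassicalSolution u (uS u) := by
  have hf := contDiff_fourier u
  have htime (t x : ℝ) : HasDerivAt (fun s : ℝ => uS u s x)
      ((1 / (2 * Real.pi) : ℂ) * ∫ p : ℝ, fourier u p * exp (I * x * p) *
        (I * ((-(p ^ 2 / 2) : ℝ) : ℂ)) * exp (I * t * ((-(p ^ 2 / 2) : ℝ) : ℂ))) t := by
    have hfc := hf.continuous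
    have := (hasDerivAt_integral_phase (h := fun p : ℝ => fourier u p * exp (I * x * p))
      (a := fun p => -(p ^ 2 / 2)) (by fun_prop) hc.mul_right (by fun_prop) t).const_mul
      (1 / (2 * Real.pi) : ℂ)
    refine this.congr_of_eventuallyEq (Filter.Eventually.of_forall fun s => ?_)
    simp only [uS]
    congr 2
    ext p
    rw [mul_assoc (fourier u p), ← exp_add]
    congr 2
    push_cast
    ring
  have hspace (t : ℝ) : uS u t = synth (modulate (fourier u) t 0) := by
    ext x; exact uS_eq_synth _ _ _
  have hgc (t : ℝ) := (contDiff_modulate hf t 0).continuous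
  have hgs (t : ℝ) := hasCompactSupport_modulate hc t 0
  have hd1 (t : ℝ) : deriv (uS u t) = synth fun p => modulate (fourier u) t 0 p * (I * p) := by
    ext x
    rw [hspace]
    exact (hasDerivAt_synth (hgc t) (hgs t) x).deriv
  have hcont1 (t : ℝ) : Continuous fun p : ℝ => modulate (fourier u) t 0 p * (I * p) :=
    (hgc t).mul (by fun_prop)
  have hsupp1 (t : ℝ) : HasCompactSupport fun p : ℝ => modulate (fourier u) t 0 p * (I * p) :=
    (hgs t).mul_right
  have hdd (t x : ℝ) := hasDerivAt_synth (hcont1 t) (hsupp1 t) x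
  have hd2 (t : ℝ) : deriv (deriv (uS u t)) =
      synth fun p => modulate (fourier u) t 0 p * (I * p) * (I * p) := by
    ext x
    rw [hd1]
    exact (hdd t x).deriv
  refine ⟨fun x => ?_, fun t x => (htime t x).differentiableAt, fun t => ?_, fun t x => ?_⟩
  · rw [uS_eq_synth, ← synth_fourier u x]
    congr 1
    ext p
    simp [modulate]
  · rw [show (2 : WithTop ℕ∞) = 1 + 1 by norm_num, contDiff_succ_iff_deriv]
    refine ⟨?_, by simp, ?_⟩
    · rw [hspace]
      exact fun x => (hasDerivAt_synth (hgc t) (hgs t) x).differentiableAt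
    · rw [contDiff_one_iff_deriv]
      refine ⟨?_, ?_⟩
      · rw [hd1]
        exact fun x => (hdd t x).differentiableAt
      · rw [hd2]
        exact continuous_synth ((hcont1 t).mul (by fun_prop)) (hsupp1 t).mul_right
  · rw [(htime t x).deriv, iteratedDeriv_succ, iteratedDeriv_one, hd2, synth, mul_left_comm,
      mul_left_comm (-(1 / 2 : ℂ))]
    congr 1
    rw [← integral_const_mul, ← integral_const_mul]
    congr 1
    ext p
    have : exp (-(1 / 2 : ℂ) * I * t * (p : ℂ) ^ 2 + I * ((0 : ℝ) : ℂ) * p) =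
        exp (I * t * ((-(p ^ 2 / 2) : ℝ) : ℂ)) := by
      congr 1; push_cast; ring
    rw [modulate, this]
    push_cast
    ring

/-! ### Moments and the quadratic variance -/

lemma integrable_mul_of_integrable_sq_mul {ρ : ℝ → ℝ} (hρc : Continuous ρ) (hρ : ∀ x, 0 ≤ ρ x)
    (h0 : Integrable ρ) (h2 : Integrable fun x => x ^ 2 * ρ x) :
    Integrable fun x => x * ρ x := by
  refine (h0.add h2).mono' (by fun_prop) (Filter.Eventually.of_forall fun x => ?_)
  rw [norm_mul, Real.norm_of_nonneg (hρ x), Real.norm_eq_abs]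
  simp only [Pi.add_apply]
  have : |x| ≤ 1 + x ^ 2 := by nlinarith [sq_nonneg (|x| - 1), sq_abs x]
  nlinarith [hρ x]

lemma integral_sq_sub_mul {ρ : ℝ → ℝ} (h0 : Integrable ρ) (h1 : Integrable fun x => x * ρ x)
    (h2 : Integrable fun x => x ^ 2 * ρ x) (m : ℝ) :
    ∫ x, (x - m) ^ 2 * ρ x =
      (∫ x, x ^ 2 * ρ x) - 2 * m * (∫ x, x * ρ x) + m ^ 2 * ∫ x, ρ x := by
  have h3 : Integrable fun x => x ^ 2 * ρ x - 2 * m * (x * ρ x) := h2.sub (h1.const_mul _)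
  rw [← integral_const_mul, ← integral_const_mul, ← integral_sub h2 (h1.const_mul _),
    ← integral_add h3 (h0.const_mul _)]
  congr 1
  ext x
  ring

lemma norm_add_I_mul_sq (z w : ℂ) (c : ℝ) :
    ‖z + I * c * w‖ ^ 2 =
      ‖z‖ ^ 2 + c * (2 * (z.im * w.re - z.re * w.im)) + c ^ 2 * ‖w‖ ^ 2 := by
  simp only [← normSq_eq_norm_sq, normSq_apply, add_re, add_im, mul_re, mul_im, I_re, I_im,
    ofReal_re, ofReal_im]
  ring

/-- Up to a unimodular factor the derivative is `f' + i(m - τp)f`; its squared norm is a quadratic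
polynomial in `m` and `τ`. The cross terms `B₀`, `B₁` only shift the vertex of the variance
parabola, so their values stay implicit. -/
lemma integral_norm_sq_deriv_modulate {f : ℝ → ℂ} (hf : ContDiff ℝ ∞ f)
    (hc : HasCompactSupport f) :
    ∃ A B₀ B₁ : ℝ, ∀ τ m : ℝ, ∫ p, ‖deriv (modulate f τ m) p‖ ^ 2 =
      A + m * B₀ - τ * B₁ + m ^ 2 * (∫ p, ‖f p‖ ^ 2) - 2 * m * τ * (∫ p, p * ‖f p‖ ^ 2) +
        τ ^ 2 * ∫ p, p ^ 2 * ‖f p‖ ^ 2 := by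
  set R : ℝ → ℝ := fun p => 2 * ((deriv f p).im * (f p).re - (deriv f p).re * (f p).im) with hR
  have hfc : Continuous f := hf.continuous
  have hdc : Continuous (deriv f) := hf.continuous_deriv (by simp)
  have key {F : ℝ → ℝ} (hF : Continuous F) (h0 : ∀ p, f p = 0 → deriv f p = 0 → F p = 0) :
      Integrable F := by
    refine hF.integrable_of_hasCompactSupport ?_
    refine HasCompactSupport.intro hc fun p hp => ?_
    exact h0 p (image_eq_zero_of_notMem_tsupport hp)
      (image_eq_zero_of_notMem_tsupport fun h => hp (tsupport_deriv_subset h))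
  have iA : Integrable fun p => ‖deriv f p‖ ^ 2 := key (by fun_prop) fun p _ h => by simp [h]
  have iB0 : Integrable R := key (by fun_prop) fun p _ h => by simp [hR, h]
  have iB1 : Integrable fun p => p * R p := key (by fun_prop) fun p _ h => by simp [hR, h]
  have iN0 : Integrable fun p => ‖f p‖ ^ 2 := key (by fun_prop) fun p h _ => by simp [h]
  have iN1 : Integrable fun p => p * ‖f p‖ ^ 2 := key (by fun_prop) fun p h _ => by simp [h]
  have iN2 : Integrable fun p => p ^ 2 * ‖f p‖ ^ 2 := key (by fun_prop) fun p h _ => by simp [h]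
  refine ⟨∫ p, ‖deriv f p‖ ^ 2, ∫ p, R p, ∫ p, p * R p, fun τ m => ?_⟩
  have hpt (p : ℝ) : ‖deriv (modulate f τ m) p‖ ^ 2 =
      ‖deriv f p‖ ^ 2 + m * R p - τ * (p * R p) + m ^ 2 * ‖f p‖ ^ 2 -
        2 * m * τ * (p * ‖f p‖ ^ 2) + τ ^ 2 * (p ^ 2 * ‖f p‖ ^ 2) := by
    rw [norm_deriv_modulate (hf.differentiable (by simp)), norm_add_I_mul_sq]
    simp only [hR]
    ring
  simp only [hpt]
  have j1 : Integrable fun p => ‖deriv f p‖ ^ 2 + m * R p := iA.add (iB0.const_mul m)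
  have j2 : Integrable fun p => ‖deriv f p‖ ^ 2 + m * R p - τ * (p * R p) :=
    j1.sub (iB1.const_mul τ)
  have j3 : Integrable fun p =>
      ‖deriv f p‖ ^ 2 + m * R p - τ * (p * R p) + m ^ 2 * ‖f p‖ ^ 2 :=
    j2.add (iN0.const_mul (m ^ 2))
  have j4 : Integrable fun p => ‖deriv f p‖ ^ 2 + m * R p - τ * (p * R p) + m ^ 2 * ‖f p‖ ^ 2 -
      2 * m * τ * (p * ‖f p‖ ^ 2) :=
    j3.sub (iN1.const_mul (2 * m * τ))
  rw [integral_add j4 (iN2.const_mul _), integral_sub j3 (iN1.const_mul _),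
    integral_add j2 (iN0.const_mul _), integral_sub j1 (iB1.const_mul _),
    integral_add iA (iB0.const_mul _)]
  simp only [integral_const_mul]

lemma integral_sq_sub_mul_norm_sq_pos {f : ℝ → ℂ} (hf : Continuous f) (hc : HasCompactSupport f)
    (hne : ∫ p, ‖f p‖ ^ 2 ≠ 0) (m : ℝ) : 0 < ∫ p, (p - m) ^ 2 * ‖f p‖ ^ 2 := by
  have hex : ∃ p, p ≠ m ∧ f p ≠ 0 := by
    by_contra! h
    refine hne ?_
    rw [integral_eq_zero_of_ae]
    filter_upwards [compl_mem_ae_iff.2 (measure_singleton m)] with p hp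
    simp [h p hp]
  obtain ⟨p, hpm, hp⟩ := hex
  refine Continuous.integral_pos_of_hasCompactSupport_nonneg_nonzero (x := p) (by fun_prop) ?_
    (fun p => by positivity) ?_
  · exact HasCompactSupport.intro hc fun p hp => by simp [image_eq_zero_of_notMem_tsupport hp]
  · exact mul_ne_zero (pow_ne_zero 2 (sub_ne_zero.2 hpm)) (pow_ne_zero 2 (norm_ne_zero_iff.2 hp))

/-- Keeping `m` free lets one identity yield the second moment, the mean and, at `m` equal to the
mean, the variance. -/
lemma moments_uS (u : 𝓢(ℝ, ℂ)) (hc : HasCompactSupport (fourier u))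
    (hnorm : ∫ p, ‖fourier u p‖ ^ 2 = 2 * Real.pi) (τ : ℝ) :
    Integrable (fun x => x * ‖uS u τ x‖ ^ 2) ∧ Integrable (fun x => x ^ 2 * ‖uS u τ x‖ ^ 2) ∧
    ∀ m : ℝ, (∫ x, x ^ 2 * ‖uS u τ x‖ ^ 2) - 2 * m * mean (uS u τ) + m ^ 2 =
      (2 * Real.pi)⁻¹ * ∫ p, ‖deriv (modulate (fourier u) τ m) p‖ ^ 2 := by
  have hf := contDiff_fourier u
  have hg := contDiff_modulate hf τ 0
  have hgc := hasCompactSupport_modulate hc τ 0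
  simp only [uS_eq_synth, mean]
  obtain ⟨h0, e0⟩ := plancherel_synth hg hgc
  simp only [norm_modulate] at e0
  rw [hnorm, inv_mul_cancel₀ (by positivity)] at e0
  have h2 := (integrable_and_integral_sq_sub_mul hf hc τ 0).1
  simp only [sub_zero] at h2
  have hsc := continuous_synth hg.continuous hgc
  have h1 := integrable_mul_of_integrable_sq_mul (by fun_prop) (fun x => sq_nonneg _) h0 h2
  refine ⟨h1, h2, fun m => ?_⟩
  have := integral_sq_sub_mul h0 h1 h2 m
  rw [e0, mul_one] at this
  rw [← this, (integrable_and_integral_sq_sub_mul hf hc τ m).2]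

lemma variance_uS (u : 𝓢(ℝ, ℂ)) (hc : HasCompactSupport (fourier u))
    (hnorm : ∫ p, ‖fourier u p‖ ^ 2 = 2 * Real.pi) (τ : ℝ) :
    variance (uS u τ) = (2 * Real.pi)⁻¹ *
      ∫ p, ‖deriv (modulate (fourier u) τ (mean (uS u τ))) p‖ ^ 2 := by
  rw [← (moments_uS u hc hnorm τ).2.2, variance, mean]
  ring

lemma exists_variance_uS_eq_quadratic (u : 𝓢(ℝ, ℂ)) (hc : HasCompactSupport (fourier u))
    (hnorm : ∫ p, ‖fourier u p‖ ^ 2 = 2 * Real.pi) :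
    ∃ a b c : ℝ, 0 < a ∧ ∀ τ, variance (uS u τ) = a * τ ^ 2 + b * τ + c := by
  have hf := contDiff_fourier u
  have hfc : Continuous (fourier u) := hf.continuous
  obtain ⟨A, B₀, B₁, hq⟩ := integral_norm_sq_deriv_modulate hf hc
  set N₁ := ∫ p, p * ‖fourier u p‖ ^ 2 with hN1
  set N₂ := ∫ p, p ^ 2 * ‖fourier u p‖ ^ 2 with hN2
  have hpi : (0 : ℝ) < 2 * Real.pi := by positivity
  have hint (k : ℕ) : Integrable fun p => p ^ k * ‖fourier u p‖ ^ 2 := by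
    refine Continuous.integrable_of_hasCompactSupport (by fun_prop) ?_
    exact HasCompactSupport.intro hc fun p hp => by simp [image_eq_zero_of_notMem_tsupport hp]
  -- Taken about its mean `N₁/2π`, this integral is `2π` times the leading coefficient.
  have hpos := integral_sq_sub_mul_norm_sq_pos hfc hc (by rw [hnorm]; exact hpi.ne')
    (N₁ / (2 * Real.pi))
  rw [integral_sq_sub_mul (ρ := fun p => ‖fourier u p‖ ^ 2) (by simpa using hint 0)
    (by simpa using hint 1) (hint 2), hnorm, ← hN1, ← hN2] at hpos
  refine ⟨N₂ / (2 * Real.pi) - (N₁ / (2 * Real.pi)) ^ 2,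
    -B₁ / (2 * Real.pi) + B₀ * N₁ / (2 * Real.pi) ^ 2,
    A / (2 * Real.pi) - (B₀ / (2 * (2 * Real.pi))) ^ 2, ?_, fun τ => ?_⟩
  · have : N₂ / (2 * Real.pi) - (N₁ / (2 * Real.pi)) ^ 2 = (2 * Real.pi)⁻¹ *
        (N₂ - 2 * (N₁ / (2 * Real.pi)) * N₁ + (N₁ / (2 * Real.pi)) ^ 2 * (2 * Real.pi)) := by
      field_simp
      ring
    rw [this]
    positivity
  · have hm := (moments_uS u hc hnorm τ).2.2
    simp only [hq, hnorm] at hm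
    -- The values at `m = 0` and `m = 1` determine the second moment and the mean.
    have hM2 := hm 0
    have hM1 := hm 1
    have e1 : mean (uS u τ) = -(B₀ / (2 * (2 * Real.pi))) + τ * N₁ / (2 * Real.pi) := by
      have : mean (uS u τ) = ((2 * Real.pi)⁻¹ * (A + 0 * B₀ - τ * B₁ + 0 ^ 2 * (2 * Real.pi) -
        2 * 0 * τ * N₁ + τ ^ 2 * N₂) + 1 - (2 * Real.pi)⁻¹ * (A + 1 * B₀ - τ * B₁ +
        1 ^ 2 * (2 * Real.pi) - 2 * 1 * τ * N₁ + τ ^ 2 * N₂)) / 2 := by linarith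
      rw [this]
      field_simp
      ring
    have e2 : variance (uS u τ) =
        (∫ x, x ^ 2 * ‖uS u τ x‖ ^ 2) - mean (uS u τ) ^ 2 := rfl
    have e3 : ∫ x, x ^ 2 * ‖uS u τ x‖ ^ 2 =
        (2 * Real.pi)⁻¹ * (A - τ * B₁ + τ ^ 2 * N₂) := by linarith
    rw [e2, e1, e3]
    field_simp
    ring

lemma existsUnique_minimiser_of_quadratic {V : ℝ → ℝ} {a b c : ℝ} (ha : 0 < a)
    (hV : ∀ τ, V τ = a * τ ^ 2 + b * τ + c) : ∃! s, ∀ τ, V s ≤ V τ := by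
  have hsq (τ : ℝ) : V τ = a * (τ + b / (2 * a)) ^ 2 + (c - b ^ 2 / (4 * a)) := by
    rw [hV]
    field_simp
    ring
  refine ⟨-(b / (2 * a)), fun τ => ?_, fun s hs => ?_⟩
  · rw [hsq, hsq τ]
    have : 0 ≤ a * (τ + b / (2 * a)) ^ 2 := by positivity
    simpa using this
  · have h := hs (-(b / (2 * a)))
    rw [hsq, hsq (-(b / (2 * a))), neg_add_cancel] at h
    have h1 : a * (s + b / (2 * a)) ^ 2 ≤ 0 := by linarith
    have h2 : (s + b / (2 * a)) ^ 2 = 0 :=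
      le_antisymm (nonpos_of_mul_nonpos_right h1 ha) (sq_nonneg _)
    linarith [pow_eq_zero_iff (two_ne_zero) |>.1 h2]

/-! ### Reduction to a quadratic phase -/

/-- The wave function as an oscillatory integral about the point `v` of stationary phase. -/
lemma uS_eq_integral_quadratic_phase (u : ℝ → ℂ) {t₀ x₀ t x v : ℝ} (hv : x = x₀ + (t - t₀) * v) :
    uS u t x = (1 / (2 * Real.pi) : ℂ) * exp (I * ((t - t₀ : ℝ) / 2) * (v : ℂ) ^ 2) *
      ∫ p, modulate (fourier u) t₀ x₀ p * exp (-I * ((t - t₀ : ℝ) / 2) * ((p : ℂ) - v) ^ 2) := by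
  rw [uS, mul_assoc (1 / (2 * Real.pi) : ℂ), ← integral_const_mul (exp (I * ((t - t₀ : ℝ) / 2) * (v : ℂ) ^ 2))]
  congr 2
  ext p
  rw [modulate, mul_assoc (fourier u p), ← exp_add, mul_left_comm, ← exp_add, hv]
  congr 2
  push_cast
  ring

/-- Extracts the same prefactor as `uS_eq_integral_quadratic_phase`, so that it factors out of the
difference. -/
lemma firstTerm_eq (u : ℝ → ℂ) {t₀ x₀ t x v : ℝ} (hv : x = x₀ + (t - t₀) * v)
    (ht : t - t₀ ≠ 0) :
    firstTerm u t₀ x₀ t x = (1 / (2 * Real.pi) : ℂ) *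
      exp (I * ((t - t₀ : ℝ) / 2) * (v : ℂ) ^ 2) * (modulate (fourier u) t₀ x₀ v *
        (Real.sqrt (2 * Real.pi) * exp (-(Real.sign (t - t₀) : ℂ) * I * (Real.pi / 4)) *
          ((|t - t₀| ^ (-(1 / 2) : ℝ) : ℝ) : ℂ))) := by
  have hv' : (x - x₀) / (t - t₀) = v := by rw [hv]; field_simp; ring
  have hc : ((1 / Real.sqrt (2 * Real.pi) : ℝ) : ℂ) =
      (1 / (2 * Real.pi) : ℂ) * Real.sqrt (2 * Real.pi) := by
    have : 1 / Real.sqrt (2 * Real.pi) = 1 / (2 * Real.pi) * Real.sqrt (2 * Real.pi) := by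
      have hs : Real.sqrt (2 * Real.pi) ^ 2 = 2 * Real.pi := Real.sq_sqrt (by positivity)
      have hs0 : Real.sqrt (2 * Real.pi) ≠ 0 := by positivity
      field_simp
      linarith
    rw [this]
    push_cast
    ring
  have he : exp (-(1 / 2 : ℂ) * I * t * (v : ℂ) ^ 2 + I * x * v) =
      exp (I * ((t - t₀ : ℝ) / 2) * (v : ℂ) ^ 2) *
        exp (-(1 / 2 : ℂ) * I * t₀ * (v : ℂ) ^ 2 + I * x₀ * v) := by
    rw [← exp_add, hv]
    congr 1
    push_cast
    ring
  simp only [firstTerm, hv']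
  rw [hc, he, modulate]
  ring

lemma norm_prefactor (T v : ℝ) :
    ‖(1 / (2 * Real.pi) : ℂ) * exp (I * ((T : ℂ) / 2) * (v : ℂ) ^ 2)‖ = (2 * Real.pi)⁻¹ := by
  have h1 : I * ((T : ℂ) / 2) * (v : ℂ) ^ 2 = ((T / 2 * v ^ 2 : ℝ) : ℂ) * I := by
    push_cast; ring
  have h2 : (1 / (2 * Real.pi) : ℂ) = (((2 * Real.pi)⁻¹ : ℝ) : ℂ) := by push_cast; ring
  rw [norm_mul, h1, norm_exp_ofReal_mul_I, mul_one, h2, norm_real,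
    Real.norm_of_nonneg (by positivity)]

end FreeSchrodinger

end

/-! ### The main theorem -/

open FreeSchrodinger MeasureTheory in
theorem theorem1p1 (u₀ : SchwartzMap ℝ ℂ) (p₁ p₂ q₁ q₂ : ℝ) (hp : p₁ < p₂)
    (hq : Set.Icc p₁ p₂ ⊆ Set.Ioo q₁ q₂)
    (hnorm : ∫ x : ℝ, ‖u₀ x‖ ^ 2 = 1)
    (hsupp : tsupport (FreeSchrodinger.fourier u₀) ⊆ Set.Icc p₁ p₂) :
    FreeSchrodinger.IsClassicalSolution u₀ (FreeSchrodinger.uS u₀) ∧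
    (∀ τ : ℝ,
      MeasureTheory.Integrable (fun x : ℝ => x * ‖FreeSchrodinger.uS u₀ τ x‖ ^ 2) ∧
      MeasureTheory.Integrable (fun x : ℝ => x ^ 2 * ‖FreeSchrodinger.uS u₀ τ x‖ ^ 2)) ∧
    (∃! s : ℝ, ∀ τ : ℝ, FreeSchrodinger.variance (FreeSchrodinger.uS u₀ s) ≤
      FreeSchrodinger.variance (FreeSchrodinger.uS u₀ τ)) ∧
    ∀ tstar xstar : ℝ,
      (∀ τ : ℝ, FreeSchrodinger.variance (FreeSchrodinger.uS u₀ tstar) ≤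
        FreeSchrodinger.variance (FreeSchrodinger.uS u₀ τ)) →
      xstar = FreeSchrodinger.mean (FreeSchrodinger.uS u₀ tstar) →
      (∀ δ : ℝ, 1 / 2 < δ → δ < 3 / 4 → ∀ t x : ℝ, t ≠ tstar →
        q₁ ≤ (x - xstar) / (t - tstar) → (x - xstar) / (t - tstar) ≤ q₂ →
        ‖FreeSchrodinger.uS u₀ t x - FreeSchrodinger.firstTerm u₀ tstar xstar t x‖ ≤
          FreeSchrodinger.C₁ δ q₁ q₂ *
            Real.sqrt (FreeSchrodinger.variance (FreeSchrodinger.uS u₀ tstar)) *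
            |t - tstar| ^ (-δ)) ∧
      (∀ t x : ℝ, t ≠ tstar →
        ((x - xstar) / (t - tstar) < q₁ ∨ q₂ < (x - xstar) / (t - tstar)) →
        ‖FreeSchrodinger.uS u₀ t x‖ ≤
          (FreeSchrodinger.C₂ p₁ p₂ q₁ q₂ *
              Real.sqrt (FreeSchrodinger.variance (FreeSchrodinger.uS u₀ tstar)) +
            FreeSchrodinger.C₃ p₁ p₂ q₁ q₂ * ∫ y : ℝ, ‖u₀ y‖) *
            |t - tstar| ^ (-1 : ℝ)) := by
  have hf := contDiff_fourier u₀
  have hc : HasCompactSupport (fourier u₀) :=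
    isCompact_Icc.of_isClosed_subset (isClosed_tsupport _) hsupp
  have hfn : ∫ p, ‖fourier u₀ p‖ ^ 2 = 2 * Real.pi := by
    have h := (plancherel_synth hf hc).2
    simp only [synth_fourier, hnorm] at h
    field_simp at h
    linarith
  have hq₁ : q₁ < p₁ := (hq (Set.left_mem_Icc.2 hp.le)).1
  have hq₂ : p₂ < q₂ := (hq (Set.right_mem_Icc.2 hp.le)).2
  -- By continuity `fourier u₀` vanishes at `p₁` and `p₂` too, as the boundary terms require.
  have hzero : ∀ p ∉ Set.Ioo p₁ p₂, fourier u₀ p = 0 := by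
    have hcl : IsClosed {p | fourier u₀ p = 0} := isClosed_eq hf.continuous continuous_const
    have hsub : (Set.Icc p₁ p₂)ᶜ ⊆ {p | fourier u₀ p = 0} := fun p hpm =>
      image_eq_zero_of_notMem_tsupport fun h => hpm (hsupp h)
    intro p hpm
    have := hcl.closure_subset_iff.2 hsub
    rw [closure_compl, interior_Icc] at this
    exact this hpm
  obtain ⟨a, b, c, ha, hV⟩ := exists_variance_uS_eq_quadratic u₀ hc hfn
  refine ⟨isClassicalSolution_uS u₀ hc, fun τ => ⟨(moments_uS u₀ hc hfn τ).1,
    (moments_uS u₀ hc hfn τ).2.1⟩, existsUnique_minimiser_of_quadratic ha hV, ?_⟩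
  intro t₀ x₀ _ hx₀
  have hg := contDiff_modulate hf t₀ x₀
  have hgd (p : ℝ) : HasDerivAt (modulate (fourier u₀) t₀ x₀)
      (deriv (modulate (fourier u₀) t₀ x₀) p) p := (hg.differentiable (by simp) p).hasDerivAt
  have hgc : Continuous (deriv (modulate (fourier u₀) t₀ x₀)) := hg.continuous_deriv (by simp)
  have hgz : ∀ p ∉ Set.Ioo p₁ p₂, modulate (fourier u₀) t₀ x₀ p = 0 := fun p hpm => by
    rw [modulate, hzero p hpm, zero_mul]
  have hgi : Integrable fun p => ‖deriv (modulate (fourier u₀) t₀ x₀) p‖ ^ 2 := by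
    refine Continuous.integrable_of_hasCompactSupport (by fun_prop) ?_
    exact HasCompactSupport.intro (hasCompactSupport_modulate hc t₀ x₀).deriv
      fun p hpm => by simp [image_eq_zero_of_notMem_tsupport hpm]
  -- The choice of `x₀` as the mean at time `t₀` enters here.
  have hsq : Real.sqrt (∫ p, ‖deriv (modulate (fourier u₀) t₀ x₀) p‖ ^ 2) =
      Real.sqrt (2 * Real.pi) * Real.sqrt (variance (uS u₀ t₀)) := by
    rw [← Real.sqrt_mul (by positivity), variance_uS u₀ hc hfn, ← hx₀,
      mul_inv_cancel_left₀ (by positivity)]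
  have hs2 : Real.sqrt (2 * Real.pi) = Real.sqrt 2 * Real.sqrt Real.pi :=
    Real.sqrt_mul (by norm_num) _
  have hss2 : Real.sqrt 2 ^ 2 = 2 := Real.sq_sqrt (by norm_num)
  have hsspi : Real.sqrt Real.pi ^ 2 = Real.pi := Real.sq_sqrt Real.pi_pos.le
  have hvx {t x : ℝ} (ht : t ≠ t₀) : x = x₀ + (t - t₀) * ((x - x₀) / (t - t₀)) := by
    rw [mul_div_cancel₀ _ (sub_ne_zero.2 ht)]; ring
  refine ⟨fun δ h1 h2 t x ht hv₁ hv₂ => ?_, fun t x ht hv => ?_⟩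
  · have hT := sub_ne_zero.2 ht
    have key := norm_integral_sub_stationary_le h1 h2 hT hv₁ hv₂ hgd hgc
      (fun p hpm => hgz p fun h => hpm ⟨hq₁.trans h.1, h.2.trans hq₂⟩) hgi
    rw [uS_eq_integral_quadratic_phase u₀ (hvx ht), firstTerm_eq u₀ (hvx ht) hT, ← mul_sub,
      norm_mul, norm_prefactor]
    refine (mul_le_mul_of_nonneg_left key (by positivity)).trans (le_of_eq ?_)
    have h2d : (2 : ℝ) ^ (δ + 1) = 2 ^ (δ + 1 / 2) * Real.sqrt 2 := by
      rw [Real.sqrt_eq_rpow, ← Real.rpow_add (by norm_num)]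
      congr 1; ring
    have hk : (2 * Real.pi)⁻¹ * Real.sqrt 2 * Real.sqrt (2 * Real.pi) = (Real.sqrt Real.pi)⁻¹ := by
      rw [hs2]
      have : Real.sqrt Real.pi ≠ 0 := by positivity
      field_simp
      rw [hss2, hsspi]
    rw [hsq, h2d, C₁, div_eq_mul_inv _ (Real.sqrt Real.pi * _), mul_inv (Real.sqrt Real.pi),
      ← hk]
    ring
  · have hT := sub_ne_zero.2 ht
    set d := min (p₁ - q₁) (q₂ - p₂) with hd
    have hd0 : 0 < d := lt_min (by linarith) (by linarith)
    have hdl := min_le_left (p₁ - q₁) (q₂ - p₂)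
    have hdr := min_le_right (p₁ - q₁) (q₂ - p₂)
    have key := norm_integral_nonstationary_le (v := (x - x₀) / (t - t₀)) hT hp.le hd0
      -- Since `d` is the smaller gap, `v < q₁` gives `v ≤ p₁ - d`, and `q₂ < v` gives `p₂ + d ≤ v`.
      (hv.imp (fun h => by linarith) (fun h => by linarith)) hgd hgc hgz hgi
      (M := ∫ y, ‖u₀ y‖) (fun p => by rw [norm_modulate]; exact norm_fourier_le _ _)
    rw [uS_eq_integral_quadratic_phase u₀ (hvx ht), norm_mul, norm_prefactor]
    refine (mul_le_mul_of_nonneg_left key (by positivity)).trans (le_of_eq ?_)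
    have hk : (2 * Real.pi)⁻¹ * Real.sqrt (2 * Real.pi) = 1 / Real.sqrt (2 * Real.pi) := by
      have hs : Real.sqrt (2 * Real.pi) ^ 2 = 2 * Real.pi := Real.sq_sqrt (by positivity)
      have hs0 : Real.sqrt (2 * Real.pi) ≠ 0 := by positivity
      field_simp
      linarith
    rw [hsq, C₂, C₃, ← hd, Real.rpow_neg_one, ← hk]
    ring
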